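/- Let $M$ be a compact smooth $n$-dimensional manifold with smooth boundary, $g$ a smooth Riemannian metric, $\alpha$ a smooth 1-form and $U$ a smooth function on $M$, and let $k>\max_M U$. Put $\Omega=d\alpha$ and let $Y$ be the Lorentz force, $\Omega_x(v,w)=(Y_xv,w)_g$. An $\mathcal{MP}$-geodesic is a $C^2$ curve with $\nabla_{\dot\sigma}\dot\sigma=Y(\dot\sigma)-\nabla U(\sigma)$; its energy $E(x,v)=\tfrac12|v|_g^2+U(x)$ is constant. Let $S^kM=\{E=k\}$, and let $\partial_+S^kM$ be the set of $(x,v)\in S^kM$ with $x\in\partial M$ and $v$ tangent to $\partial M$ or pointing inwards. Assume that $(g,\alpha,U)$ is simple at energy $k$, that is: (a) $\partial M$ is strictly $\mathcal{MP}$-convex: for some smooth extension of the system across the boundary, every $x\in\partial M$ has a neighbourhood $O$ such that the $\mathcal{MP}$-geodesics of energy $k$ in $O$ which pass through $x$ and are tangent to $\partial M$ at $x$ meet $M$ only at $x$; (b) for every $x\in M$ the exponential map $\exp_x(tv)=\sigma_{x,v}(t)$ (where $t\ge 0$, $v\in S^k_xM$, and $\sigma_{x,v}$ is the $\mathcal{MP}$-geodesic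 with initial data $(x,v)$) is a $C^1$ diffeomorphism from $\exp_x^{-1}(M)\subset T_xM$ onto $M$. For square integrable $\mathbf f=[h,\beta,V]$ ($h$ a symmetric 2-tensor, $\beta$ a 1-form, $V$ a function on $M$) the $\mathcal{MP}$-ray transform is $$I\mathbf f(x,v)=\int_0^{\tau(x,v)}\big\{h_{ij}(\sigma)\dot\sigma^i\dot\sigma^j+\beta_i(\sigma)\dot\sigma^i+V(\sigma)\big\}\,dt,\qquad (x,v)\in\partial_+S^kM \text{ (a.e.)},$$ with $\sigma=\sigma_{x,v}$ and $\tau(x,v)$ its exit time. Call $\mathbf f$ a potential if there are a 1-form $u$ and a function $\varphi$ in $H^1_0(M)$ and $\eta\in L^2(M)$ such that $$h=d^su-\tfrac12\eta g,\qquad \beta=-Y(u)+d\varphi,\qquad V=-(dU,u)_g+(k-U)\eta,$$ where $d^su$ is the symmetrized covariant derivative and $Y(u)_i=-Y_i^ju_j$. The transform $I$ is s-injective if every square integrable $\mathbf f$ with $I\mathbf f=0$ almost everywhere is a potential. Let $G=2(k-U)g$, so that $(G,\alpha)$ is the magnetic reduction. Its magnetic ray transform $I_{\mathcal M}$ is given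 by $I_{\mathcal M}[h,\beta](x,v)=\int_0^{\tau_G(x,v)}\{h_{ij}(\gamma)\dot\gamma^i\dot\gamma^j+\beta_i(\gamma)\dot\gamma^i\}\,ds$, for almost every $G$-unit vector $(x,v)$ at $\partial M$ which is tangent to $\partial M$ or points inwards, where $\gamma$ is the unit speed magnetic geodesic ($\nabla^G_{\dot\gamma}\dot\gamma=Y_G(\dot\gamma)$) with initial data $(x,v)$ and $\tau_G(x,v)$ is its exit time. It is s-injective if every square integrable pair $[h,\beta]$, $h$ symmetric, with $I_{\mathcal M}[h,\beta]=0$ almost everywhere is of the form $h=d^s_Gu$, $\beta=-Y_G(u)+d\varphi$ with $u,\varphi\in H^1_0(M)$, where $d^s_G$ and $Y_G$ are taken with respect to $G$. Then $I_{\mathcal M}$ is s-injective if and only if $I$ is s-injective. -/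

import Mathlib

open Set Filter Topology MeasureTheory Bundle
open scoped Manifold ContDiff ENNReal

noncomputable section

namespace MPRay

/-! ### Coordinate formulas on `ℝⁿ`

Here `γ` is the Gram matrix of a metric, `a` the components of the magnetic potential and `u` the
potential function, all as functions of the coordinates. Partial derivatives are taken within a
set `S`: the closed half-space for charts of a manifold with boundary, the whole space for
coefficients extended across the boundary. -/

/-- The Euclidean space `ℝⁿ` on which manifolds of dimension `n` are modelled. -/
abbrev E (n : ℕ) : Type := EuclideanSpace ℝ (Fin n)

/-- The `i`-th standard basis vector of `ℝⁿ`. -/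
def stdVec {n : ℕ} (i : Fin n) : E n := EuclideanSpace.single i (1 : ℝ)

/-- The partial derivative `∂ᵢ f (y)` within `S`. -/
def pderiv {n : ℕ} (S : Set (E n)) (f : E n → ℝ) (y : E n) (i : Fin n) : ℝ :=
  fderivWithin ℝ f S y (stdVec i)

/-- The Christoffel symbol `Γˡᵢⱼ = ½ gˡᵐ (∂ᵢ gⱼₘ + ∂ⱼ gᵢₘ - ∂ₘ gᵢⱼ)`. -/
def christoffel {n : ℕ} (S : Set (E n)) (γ : E n → Matrix (Fin n) (Fin n) ℝ) (y : E n)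
    (l i j : Fin n) : ℝ :=
  (1 / 2 : ℝ) * ∑ m, (γ y)⁻¹ l m *
    (pderiv S (fun z => γ z j m) y i + pderiv S (fun z => γ z i m) y j
      - pderiv S (fun z => γ z i j) y m)

/-- The component `Ωᵢⱼ = ∂ᵢ aⱼ - ∂ⱼ aᵢ` of the magnetic field `Ω = dα`. -/
def magField {n : ℕ} (S : Set (E n)) (a : E n → Fin n → ℝ) (y : E n) (i j : Fin n) : ℝ :=
  pderiv S (fun z => a z j) y i - pderiv S (fun z => a z i) y j

/-- The component `Yˡᵢ = gˡᵐ Ωᵢₘ` of the Lorentz force, that is, `Ω(v, w) = (Y v, w)_g`. -/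
def lorentz {n : ℕ} (S : Set (E n)) (γ : E n → Matrix (Fin n) (Fin n) ℝ)
    (a : E n → Fin n → ℝ) (y : E n) (l i : Fin n) : ℝ :=
  ∑ m, (γ y)⁻¹ l m * magField S a y i m

/-- The coordinate acceleration `- Γ(v, v) + Y v - ∇u` prescribed by the equation
`∇_{σ'} σ' = Y σ' - ∇u` to a curve through `y` with velocity `v`. -/
def accel {n : ℕ} (S : Set (E n)) (γ : E n → Matrix (Fin n) (Fin n) ℝ)
    (a : E n → Fin n → ℝ) (u : E n → ℝ) (y v : E n) : E n :=
  WithLp.toLp 2 fun l =>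
    - (∑ i, ∑ j, christoffel S γ y l i j * v i * v j)
      + (∑ i, lorentz S γ a y l i * v i)
      - ∑ m, (γ y)⁻¹ l m * pderiv S u y m

/-! ### Manifolds with boundary, metrics and tensor fields -/

section Manifold

variable {n : ℕ} [NeZero n] {M : Type*} [TopologicalSpace M]
  [ChartedSpace (EuclideanHalfSpace n) M]

variable (n M) in
/-- Covariant tensor fields of rank one (not necessarily continuous). -/
abbrev OneForm : Type _ := ∀ x : M, TangentSpace (𝓡∂ n) x →L[ℝ] ℝ

variable (n M) in
/-- Covariant tensor fields of rank two (not necessarily continuous). -/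
abbrev TwoTensor : Type _ :=
  ∀ x : M, TangentSpace (𝓡∂ n) x →L[ℝ] TangentSpace (𝓡∂ n) x →L[ℝ] ℝ

/-- The coordinate vector `∂ᵢ` of the chart around `p`, at the point with coordinates `y`. -/
def frame (p : M) (y : E n) (i : Fin n) :
    TangentSpace (𝓡∂ n) ((extChartAt (𝓡∂ n) p).symm y) :=
  mfderivWithin 𝓘(ℝ, E n) (𝓡∂ n) (extChartAt (𝓡∂ n) p).symm (range (𝓡∂ n)) y (stdVec i)

/-- The coordinate vector `∂ᵢ` at `x` of the preferred chart around `x`; Mathlib identifies `T_x M`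
with the model space through this chart, and `∂ᵢ` with the `i`-th standard basis vector. -/
def baseVec (x : M) (i : Fin n) : TangentSpace (𝓡∂ n) x := (stdVec i : E n)

/-- The coordinate covector `dxⁱ` at `x`, for the preferred chart around `x`. -/
def dcoord (x : M) (i : Fin n) : TangentSpace (𝓡∂ n) x →L[ℝ] ℝ :=
  (EuclideanSpace.proj i : E n →L[ℝ] ℝ)

variable [IsManifold (𝓡∂ n) ∞ M]

variable (n M) in
/-- Smooth Riemannian metrics on `M`. -/
abbrev RMetric : Type _ :=
  ContMDiffRiemannianMetric (𝓡∂ n) ∞ (E n) (fun x : M => TangentSpace (𝓡∂ n) x)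

/-- Smoothness of a 1-form, as a section of the cotangent bundle. -/
def SmoothOneForm (α : OneForm n M) : Prop :=
  ContMDiff (𝓡∂ n) ((𝓡∂ n).prod 𝓘(ℝ, E n →L[ℝ] ℝ)) ∞
    (fun x : M => TotalSpace.mk' (E n →L[ℝ] ℝ)
      (E := fun x : M => TangentSpace (𝓡∂ n) x →L[ℝ] Bundle.Trivial M ℝ x) x (α x))

/-- The conformal metric `2 (k - U) g`. -/
def reducedMetric (g : RMetric n M) (U : M → ℝ) (k : ℝ)
    (hU : ContMDiff (𝓡∂ n) 𝓘(ℝ, ℝ) ∞ U) (hk : ∀ x, U x < k) : RMetric n M where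
  inner x := (2 * (k - U x)) • g.inner x
  symm x v w := by
    simp only [smul_apply, g.symm x v w]
  pos x v hv := by
    simp only [smul_apply, smul_eq_mul]
    exact mul_pos (by linarith [hk x]) (g.pos x v hv)
  isVonNBounded x := by
    have hP : 0 < 2 * (k - U x) := by linarith [hk x]
    have hs : 0 < Real.sqrt (2 * (k - U x)) := Real.sqrt_pos.2 hP
    have h1 := (g.isVonNBounded x).image
      ((Real.sqrt (2 * (k - U x)))⁻¹ • ContinuousLinearMap.id ℝ (TangentSpace (𝓡∂ n) x))
    refine h1.subset fun v hv => (mem_image _ _ _).2 ⟨Real.sqrt (2 * (k - U x)) • v, ?_, ?_⟩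
    · simp only [mem_ofPred_eq, map_smul, smul_apply, smul_eq_mul] at hv ⊢
      rw [← mul_assoc, Real.mul_self_sqrt hP.le]
      exact hv
    · change (Real.sqrt (2 * (k - U x)))⁻¹ • (Real.sqrt (2 * (k - U x)) • v) = v
      rw [smul_smul, inv_mul_cancel₀ hs.ne', one_smul]
  contMDiff := by
    have h : ContMDiff (𝓡∂ n) 𝓘(ℝ, ℝ) ∞ (fun x => 2 * (k - U x)) :=
      contMDiff_const.mul (contMDiff_const.sub hU)
    intro x
    have hg := g.contMDiff x
    rw [contMDiffAt_hom_bundle] at hg ⊢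
    refine ⟨hg.1, ((h x).smul hg.2).congr_of_eventuallyEq ?_⟩
    refine Eventually.of_forall fun y => ?_
    simp only [ContinuousLinearMap.inCoordinates, ContinuousLinearMap.smul_comp,
      ContinuousLinearMap.comp_smul, Pi.smul_apply']

/-- The coordinates of `x` in the preferred chart around `x`. -/
def coord (x : M) : E n := extChartAt (𝓡∂ n) x x

/-- The Gram matrix of `g` in the chart around `p`. -/
def gram (g : RMetric n M) (p : M) (y : E n) : Matrix (Fin n) (Fin n) ℝ :=
  fun i j => g.inner ((extChartAt (𝓡∂ n) p).symm y) (frame p y i) (frame p y j)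

/-- The components of a 1-form in the chart around `p`. -/
def comp1 (β : OneForm n M) (p : M) (y : E n) : Fin n → ℝ :=
  fun i => β ((extChartAt (𝓡∂ n) p).symm y) (frame p y i)

/-- The components of a 2-tensor in the chart around `p`. -/
def comp2 (h : TwoTensor n M) (p : M) (y : E n) : Matrix (Fin n) (Fin n) ℝ :=
  fun i j => h ((extChartAt (𝓡∂ n) p).symm y) (frame p y i) (frame p y j)

/-- The coordinate expression of a function in the chart around `p`. -/
def comp0 (V : M → ℝ) (p : M) (y : E n) : ℝ := V ((extChartAt (𝓡∂ n) p).symm y)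

/-- The entries `gⁱʲ` of the inverse metric at `x`, in the preferred chart around `x`. -/
def gInv (g : RMetric n M) (x : M) : Matrix (Fin n) (Fin n) ℝ := (gram g x (coord x))⁻¹

/-- The pointwise inner product `(β, δ)_g = gⁱʲ βᵢ δⱼ` of 1-forms at `x`. -/
def inner1 (g : RMetric n M) (x : M) (β δ : TangentSpace (𝓡∂ n) x →L[ℝ] ℝ) : ℝ :=
  ∑ i, ∑ j, gInv g x i j * β (baseVec x i) * δ (baseVec x j)

/-- The pointwise squared norm `|h|_g² = gⁱᵏ gʲˡ hᵢⱼ hₖₗ` of a 2-tensor at `x`. -/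
def normSq2 (g : RMetric n M) (x : M)
    (h : TangentSpace (𝓡∂ n) x →L[ℝ] TangentSpace (𝓡∂ n) x →L[ℝ] ℝ) : ℝ :=
  ∑ i, ∑ j, ∑ k, ∑ l, gInv g x i k * gInv g x j l *
    h (baseVec x i) (baseVec x j) * h (baseVec x k) (baseVec x l)

/-- The Lorentz force `Y : T_x M → T_x M` of `Ω = dα` with respect to `g`. -/
def lorentzForce (g : RMetric n M) (α : OneForm n M) (x : M) (v : TangentSpace (𝓡∂ n) x) :
    TangentSpace (𝓡∂ n) x :=
  ∑ l, (∑ i, lorentz (range (𝓡∂ n)) (gram g x) (comp1 α x) (coord x) l i * dcoord x i v) •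
    baseVec x l

/-- The covariant derivative `(∇u)ᵢⱼ = ∂ᵢ uⱼ - Γˡᵢⱼ uₗ` of a 1-form, for the Levi-Civita
connection of `g`. -/
def covDeriv (g : RMetric n M) (u : OneForm n M) : TwoTensor n M := fun x =>
  ∑ i, ∑ j, (pderiv (range (𝓡∂ n)) (fun y => comp1 u x y j) (coord x) i
      - ∑ l, christoffel (range (𝓡∂ n)) (gram g x) (coord x) l i j * comp1 u x (coord x) l) •
    (dcoord x i).smulRight (dcoord x j)

/-- The differential of a function, as a 1-form. -/
def dfun (φ : M → ℝ) : OneForm n M := fun x =>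
  (mfderiv (𝓡∂ n) 𝓘(ℝ, ℝ) φ x : TangentSpace (𝓡∂ n) x →L[ℝ] ℝ)

/-! ### Geodesics -/

/-- The velocity of a curve parametrized by `[0, T]`, as a tangent vector of `M`. -/
def velocity (σ : ℝ → M) (T t : ℝ) : TangentSpace (𝓡∂ n) (σ t) :=
  mfderivWithin 𝓘(ℝ, ℝ) (𝓡∂ n) σ (Icc 0 T) t (1 : ℝ)

/-- The restriction of `σ` to `[0, T]`, `T > 0`, is an `MP`-geodesic in `M`: a `C²` curve which
satisfies `∇_{σ'} σ' = Y σ' - ∇U`, written at each time in the preferred chart around `σ t`. -/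
def IsGeodesic (g : RMetric n M) (α : OneForm n M) (U : M → ℝ) (σ : ℝ → M) (T : ℝ) : Prop :=
  0 < T ∧ ContMDiffOn 𝓘(ℝ, ℝ) (𝓡∂ n) 2 σ (Icc 0 T) ∧
  ∀ t ∈ Icc 0 T,
    let c : ℝ → E n := fun s => extChartAt (𝓡∂ n) (σ t) (σ s)
    derivWithin (derivWithin c (Icc 0 T)) (Icc 0 T) t =
      accel (range (𝓡∂ n)) (gram g (σ t)) (comp1 α (σ t)) (comp0 U (σ t)) (c t)
        (derivWithin c (Icc 0 T) t)

/-- `σ` starts at the tangent vector `ξ`, that is, `(σ 0, σ' 0) = ξ`. -/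
def StartsAt (σ : ℝ → M) (T : ℝ) (ξ : TangentBundle (𝓡∂ n) M) : Prop :=
  (⟨σ 0, velocity σ T 0⟩ : TangentBundle (𝓡∂ n) M) = ξ

/-- The energy `E(x, v) = ½ |v|_g² + U(x)`. -/
def energy (g : RMetric n M) (U : M → ℝ) (ξ : TangentBundle (𝓡∂ n) M) : ℝ :=
  (1 / 2 : ℝ) * g.inner ξ.proj ξ.snd ξ.snd + U ξ.proj

/-- The graph of the `MP`-exponential map of energy `k` at `x`, for geodesics in `M`:
`exp_x (t v) = σ t`, where `σ` is the geodesic in `M` with `(σ 0, σ' 0) = (x, v)`, `v ∈ S_x^k M`. -/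
def ExpRel (g : RMetric n M) (α : OneForm n M) (U : M → ℝ) (k : ℝ) (x : M) (w : E n) (y : M) :
    Prop :=
  (w = 0 ∧ y = x) ∨
  ∃ (t : ℝ) (v : E n) (σ : ℝ → M),
    energy g U ⟨x, v⟩ = k ∧ w = t • v ∧
    IsGeodesic g α U σ t ∧ StartsAt σ t ⟨x, v⟩ ∧ σ t = y

/-- `exp_x` is a diffeomorphism from `exp_x⁻¹(M) ⊆ T_x M` onto `M`. Diffeomorphism is meant in the
class `C¹`: for a nonzero magnetic field the exponential map is smooth away from `0`, but only `C¹`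
at `0`. -/
def ExpIsDiffeo (g : RMetric n M) (α : OneForm n M) (U : M → ℝ) (k : ℝ) (x : M) : Prop :=
  ∃ (exp : E n → M) (log : M → E n),
    (∀ w y, ExpRel g α U k x w y ↔ w = log y) ∧
    Function.LeftInverse exp log ∧
    ContMDiffOn 𝓘(ℝ, E n) (𝓡∂ n) 1 exp (range log) ∧
    ContMDiff (𝓡∂ n) 𝓘(ℝ, E n) 1 log

/-- Strict `MP`-convexity of the boundary at a boundary point `x`. In the chart around `x`, where `M`
is the half-space `{y₀ ≥ 0}`, the system extends smoothly across the boundary to a neighbourhood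
`O` of `x`, so that all geodesics of energy `k` in `O` which pass through `x` and are tangent to
`∂M` at `x` meet `M` only at `x`. -/
def StrictlyConvexAt (g : RMetric n M) (α : OneForm n M) (U : M → ℝ) (k : ℝ) (x : M) : Prop :=
  ∃ (O : Set (E n)) (γ : E n → Matrix (Fin n) (Fin n) ℝ) (a : E n → Fin n → ℝ) (u : E n → ℝ),
    IsOpen O ∧ coord x ∈ O ∧ O ∩ range (𝓡∂ n) ⊆ (extChartAt (𝓡∂ n) x).target ∧
    (∀ i j, ContDiffOn ℝ ∞ (fun y => γ y i j) O) ∧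
    (∀ i, ContDiffOn ℝ ∞ (fun y => a y i) O) ∧ ContDiffOn ℝ ∞ u O ∧
    (∀ y ∈ O, (γ y).PosDef) ∧
    (∀ y ∈ O ∩ range (𝓡∂ n), γ y = gram g x y ∧ a y = comp1 α x y ∧ u y = comp0 U x y) ∧
    ∀ (r s : ℝ) (c c' : ℝ → E n), r < 0 → 0 < s →
      (∀ t ∈ Ioo r s, c t ∈ O ∧ HasDerivAt c (c' t) t ∧
        HasDerivAt c' (accel univ γ a u (c t) (c' t)) t) →
      c 0 = coord x → c' 0 0 = 0 →
      (1 / 2 : ℝ) * (∑ i, ∑ j, γ (c 0) i j * c' 0 i * c' 0 j) + u (c 0) = k →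
      ∀ t ∈ Ioo r s, 0 ≤ c t 0 → c t = coord x

/-- `(g, α, U)` is a simple `MP`-system of energy `k` on `M`. -/
def IsSimple (g : RMetric n M) (α : OneForm n M) (U : M → ℝ) (k : ℝ) : Prop :=
  (∀ x ∈ (𝓡∂ n).boundary M, StrictlyConvexAt g α U k x) ∧ ∀ x : M, ExpIsDiffeo g α U k x

/-! ### The ray transform -/

/-- The point of `∂ℝⁿ₊ = {y₀ = 0}` with the given remaining coordinates. -/
def bdryCoord (z : {i : Fin n // i ≠ 0} → ℝ) : E n :=
  WithLp.toLp 2 fun i => if h : i = 0 then 0 else z ⟨i, h⟩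

/-- The positive multiple of `w ≠ 0` which has energy `k`. -/
def toEnergy (g : RMetric n M) (U : M → ℝ) (k : ℝ) (x : M) (w : TangentSpace (𝓡∂ n) x) :
    TangentBundle (𝓡∂ n) M :=
  ⟨x, Real.sqrt (2 * (k - U x) / g.inner x w w) • w⟩

/-- A property holds at almost every point of
`∂₊S^k M = {(x, v) : x ∈ ∂M, E(x, v) = k, v is tangent to ∂M or points inwards}`.
The null sets are those of any smooth positive density on this manifold. They are described in the
coordinates `z` of `∂M` and homogeneous coordinates `w` of the fibre `S_x^k M`: the map
`(z, w) ↦ (x, v)`, with `v` the multiple of `∑ wⁱ ∂ᵢ` of energy `k`, is a submersion. -/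
def AEInflux (g : RMetric n M) (U : M → ℝ) (k : ℝ) (Q : TangentBundle (𝓡∂ n) M → Prop) : Prop :=
  ∀ p : M, ∀ᵐ zw : ({i : Fin n // i ≠ 0} → ℝ) × E n,
    bdryCoord zw.1 ∈ (extChartAt (𝓡∂ n) p).target → zw.2 ≠ 0 → 0 ≤ zw.2 0 →
      Q (toEnergy g U k ((extChartAt (𝓡∂ n) p).symm (bdryCoord zw.1))
        (∑ i, zw.2 i • frame p (bdryCoord zw.1) i))

/-- The geodesic `σ` starts at `ξ ∈ ∂₊S^k M` and `T > 0` is its exit time. -/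
def IsExitGeodesic (g : RMetric n M) (α : OneForm n M) (U : M → ℝ)
    (ξ : TangentBundle (𝓡∂ n) M) (σ : ℝ → M) (T : ℝ) : Prop :=
  IsGeodesic g α U σ T ∧ StartsAt σ T ξ ∧
    (∀ t ∈ Ioo 0 T, σ t ∈ (𝓡∂ n).interior M) ∧ σ T ∈ (𝓡∂ n).boundary M

/-- The integrand `hᵢⱼ(σ) σ'ⁱ σ'ʲ + βᵢ(σ) σ'ⁱ + V(σ)` at time `t`. -/
def rayIntegrand (h : TwoTensor n M) (β : OneForm n M) (V : M → ℝ) (σ : ℝ → M) (T t : ℝ) : ℝ :=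
  h (σ t) (velocity σ T t) (velocity σ T t) + β (σ t) (velocity σ T t) + V (σ t)

/-- The value of the ray transform of `[h, β, V]` on the curve `σ : [0, T] → M`. -/
def rayIntegral (h : TwoTensor n M) (β : OneForm n M) (V : M → ℝ) (σ : ℝ → M) (T : ℝ) : ℝ :=
  ∫ t in (0 : ℝ)..T, rayIntegrand h β V σ T t

/-- `I [h, β, V] = 0` for the `MP`-ray transform `I` of `(g, α, U)` at energy `k`, as an element of
`L²(∂₊S^k M)`: for almost every `(x, v) ∈ ∂₊S^k M`, the integral of `[h, β, V]` along the geodesic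
issued from `(x, v)`, up to its exit time, exists and vanishes. (On a simple system this geodesic and
its exit time exist and are unique whenever `v` is not tangent to `∂M`; the tangent vectors form a
null set.) -/
def RayTransformEqZero (g : RMetric n M) (α : OneForm n M) (U : M → ℝ) (k : ℝ)
    (h : TwoTensor n M) (β : OneForm n M) (V : M → ℝ) : Prop :=
  AEInflux g U k fun ξ => ∀ (σ : ℝ → M) (T : ℝ), IsExitGeodesic g α U ξ σ T →
    IntervalIntegrable (rayIntegrand h β V σ T) volume 0 T ∧ rayIntegral h β V σ T = 0

/-! ### Function spaces -/

section Spaces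

variable [MeasurableSpace M]

/-- The Riemannian volume measure: the least measure which dominates, for each chart, the
image of the coordinate measure `√det g dy`. On overlaps these local measures agree. -/
def vol (g : RMetric n M) : Measure M :=
  ⨆ p : M, Measure.map (extChartAt (𝓡∂ n) p).symm
    ((volume.restrict (extChartAt (𝓡∂ n) p).target).withDensity
      fun y => ENNReal.ofReal (Real.sqrt (gram g p y).det))

/-- Measurability of a function: its coordinate expressions are Lebesgue measurable. -/
def AEMeas0 (V : M → ℝ) : Prop :=
  ∀ p : M, AEMeasurable (comp0 V p) (volume.restrict (extChartAt (𝓡∂ n) p).target)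

/-- Measurability of a 1-form: its components in charts are Lebesgue measurable. -/
def AEMeas1 (β : OneForm n M) : Prop :=
  ∀ (p : M) (i : Fin n), AEMeasurable (fun y => comp1 β p y i)
    (volume.restrict (extChartAt (𝓡∂ n) p).target)

/-- Measurability of a 2-tensor: its components in charts are Lebesgue measurable. -/
def AEMeas2 (h : TwoTensor n M) : Prop :=
  ∀ (p : M) (i j : Fin n), AEMeasurable (fun y => comp2 h p y i j)
    (volume.restrict (extChartAt (𝓡∂ n) p).target)

/-- `[h, β, V] ∈ 𝐋²(M)`: a square integrable triple of a symmetric 2-tensor, a 1-form and a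
function. -/
def MemL2Triple (g : RMetric n M) (h : TwoTensor n M) (β : OneForm n M) (V : M → ℝ) : Prop :=
  (∀ x v w, h x v w = h x w v) ∧ AEMeas2 h ∧ AEMeas1 β ∧ AEMeas0 (n := n) V ∧
  ∫⁻ x, ENNReal.ofReal (normSq2 g x (h x) + inner1 g x (β x) (β x) + V x ^ 2) ∂(vol g) < ⊤

/-- `[h, β] ∈ 𝐋²(M)`: a square integrable pair of a symmetric 2-tensor and a 1-form. -/
def MemL2Pair (g : RMetric n M) (h : TwoTensor n M) (β : OneForm n M) : Prop :=
  (∀ x v w, h x v w = h x w v) ∧ AEMeas2 h ∧ AEMeas1 β ∧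
  ∫⁻ x, ENNReal.ofReal (normSq2 g x (h x) + inner1 g x (β x) (β x)) ∂(vol g) < ⊤

/-- `η ∈ L²(M)`. -/
def MemL2Fun (g : RMetric n M) (η : M → ℝ) : Prop :=
  AEMeas0 (n := n) η ∧ ∫⁻ x, ENNReal.ofReal (η x ^ 2) ∂(vol g) < ⊤

/-- The 1-form `u` belongs to `H¹₀(M)` and its (weak) covariant derivative is `Du`: in the `H¹`
norm, `u` is the limit of smooth 1-forms `uₘ` with compact support in the interior of `M`. -/
def IsH10Form (g : RMetric n M) (u : OneForm n M) (Du : TwoTensor n M) : Prop :=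
  AEMeas1 u ∧ AEMeas2 Du ∧
  ∃ um : ℕ → OneForm n M,
    (∀ m, SmoothOneForm (um m) ∧ closure {x | um m x ≠ 0} ⊆ (𝓡∂ n).interior M) ∧
    Tendsto (fun m => ∫⁻ x, ENNReal.ofReal (inner1 g x (um m x - u x) (um m x - u x)) ∂(vol g))
      atTop (𝓝 0) ∧
    Tendsto (fun m => ∫⁻ x, ENNReal.ofReal (normSq2 g x (covDeriv g (um m) x - Du x)) ∂(vol g))
      atTop (𝓝 0)

/-- The function `φ` belongs to `H¹₀(M)` and its (weak) differential is `Dφ`: in the `H¹` norm,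
`φ` is the limit of smooth functions with compact support in the interior of `M`. -/
def IsH10Fun (g : RMetric n M) (φ : M → ℝ) (Dφ : OneForm n M) : Prop :=
  AEMeas0 (n := n) φ ∧ AEMeas1 Dφ ∧
  ∃ φm : ℕ → M → ℝ,
    (∀ m, ContMDiff (𝓡∂ n) 𝓘(ℝ, ℝ) ∞ (φm m) ∧ tsupport (φm m) ⊆ (𝓡∂ n).interior M) ∧
    Tendsto (fun m => ∫⁻ x, ENNReal.ofReal ((φm m x - φ x) ^ 2) ∂(vol g)) atTop (𝓝 0) ∧
    Tendsto (fun m => ∫⁻ x, ENNReal.ofReal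
      (inner1 g x (dfun (φm m) x - Dφ x) (dfun (φm m) x - Dφ x)) ∂(vol g)) atTop (𝓝 0)

/-! ### Potentials and s-injectivity -/

/-- `[h, β, V]` is a potential of the `MP`-system `(g, α, U)` of energy `k`: for some
`[u, φ] ∈ H¹₀(M)` and `η ∈ L²(M)`, almost everywhere
`h = dˢu - ½ η g`, `β = -Y(u) + dφ`, `V = -(dU, u)_g + (k - U) η`.
Here `dˢu` is the symmetrization of `∇u`, and `Y(u) = -u ∘ Y` on covectors. -/
def IsMPPotential (g : RMetric n M) (α : OneForm n M) (U : M → ℝ) (k : ℝ)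
    (h : TwoTensor n M) (β : OneForm n M) (V : M → ℝ) : Prop :=
  ∃ (u : OneForm n M) (Du : TwoTensor n M) (φ : M → ℝ) (Dφ : OneForm n M) (η : M → ℝ),
    IsH10Form g u Du ∧ IsH10Fun g φ Dφ ∧ MemL2Fun g η ∧
    ∀ᵐ x ∂(vol g),
      (∀ v w, h x v w = (1 / 2 : ℝ) * (Du x v w + Du x w v)
        - (1 / 2 : ℝ) * η x * g.inner x v w) ∧
      (∀ v, β x v = u x (lorentzForce g α x v) + Dφ x v) ∧
      V x = - inner1 g x (dfun U x) (u x) + (k - U x) * η x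

/-- `[h, β]` is a potential of the magnetic system `(G, α)`: for some `[u, φ] ∈ H¹₀(M)`, almost
everywhere `h = dˢu` and `β = -Y(u) + dφ`, with `dˢ` and `Y` taken with respect to `G`. -/
def IsMagneticPotential (G : RMetric n M) (α : OneForm n M) (h : TwoTensor n M)
    (β : OneForm n M) : Prop :=
  ∃ (u : OneForm n M) (Du : TwoTensor n M) (φ : M → ℝ) (Dφ : OneForm n M),
    IsH10Form G u Du ∧ IsH10Fun G φ Dφ ∧
    ∀ᵐ x ∂(vol G),
      (∀ v w, h x v w = (1 / 2 : ℝ) * (Du x v w + Du x w v)) ∧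
      (∀ v, β x v = u x (lorentzForce G α x v) + Dφ x v)

/-- The `MP`-ray transform of `(g, α, U)` at energy `k` is s-injective. -/
def MPSInjective (g : RMetric n M) (α : OneForm n M) (U : M → ℝ) (k : ℝ) : Prop :=
  ∀ (h : TwoTensor n M) (β : OneForm n M) (V : M → ℝ), MemL2Triple g h β V →
    RayTransformEqZero g α U k h β V → IsMPPotential g α U k h β V

/-- The magnetic ray transform of `(G, α)`, that is, the integration of `[h, β]` along the unit speed
magnetic geodesics (`U = 0` and energy `1/2`), is s-injective. -/
def MagneticSInjective (G : RMetric n M) (α : OneForm n M) : Prop :=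
  ∀ (h : TwoTensor n M) (β : OneForm n M), MemL2Pair G h β →
    RayTransformEqZero G α 0 (1 / 2) h β 0 → IsMagneticPotential G α h β

end Spaces

end Manifold

end MPRay

end

/-! Write P = 2(k - U), so that G = P g. On the energy level k one has |v|_g² = P, hence v/P is a
G-unit vector. The new parameter ds = P dt turns `MP`-geodesics of energy k into unit speed magnetic
geodesics of (G, α) with the same trace, and conversely (Maupertuis' principle). On such rays |v|_g²
= P lets the function V be traded for the tensor P⁻¹ V g: the integral of [h, β, V] along an
`MP`-ray equals that of [P h + V g, β] along the magnetic ray. A magnetic pair [h, β] comes in this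
way from the triple [P⁻¹ h, β, 0]. Thus the kernels of the two transforms correspond.

Potentials correspond as well. Let w and u = P w be the covectors which represent one vector field X
with respect to g and G. Since L_X(P g) = P L_X g + (X P) g, one gets dˢ_G u = P dˢw - (dU, w)_g g,
while Y_G = P⁻¹ Y gives u ∘ Y_G = w ∘ Y. The extra multiple of g is exactly what η absorbs, and η is
forced by the equation for V: (k - U) η = V + (dU, w)_g.

The dynamical half is proved for two conformal systems with (k - U) g = (k' - U') g', a relation
symmetric in the two, so that one statement, `IsConformal.rayTransformEqZero`, serves both
directions. It rests on `accel_conformal`, on conservation of energy (`energy_velocity_eq`) and on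
the time change `exists_reparam`. The analytic half rests on `IsConformal.covDeriv_eq` and
`IsConformal.isH10Form`: the conformal factor, its inverse and its differential are bounded on the
compact manifold, so L² and H¹₀ are the same for both metrics. -/

noncomputable section

namespace MPRay

set_option linter.unusedSectionVars false

/-! ### Coordinate frames and smoothness of components in charts -/

section Frame

variable {n : ℕ} [NeZero n] {M : Type*} [TopologicalSpace M]
  [ChartedSpace (EuclideanHalfSpace n) M]

lemma stdVec_apply (i j : Fin n) : (stdVec i : E n) j = if j = i then 1 else 0 := by
  simp [stdVec]

lemma sum_smul_stdVec (v : E n) : ∑ i, v i • stdVec i = v := by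
  ext j
  simp [stdVec, Pi.single_apply]

lemma uniqueDiffOn_range : UniqueDiffOn ℝ (range (𝓡∂ n)) := (𝓡∂ n).uniqueDiffOn

lemma uniqueDiffWithinAt_range {p : M} {y : E n} (hy : y ∈ (extChartAt (𝓡∂ n) p).target) :
    UniqueDiffWithinAt ℝ (range (𝓡∂ n)) y :=
  uniqueDiffOn_range y (extChartAt_target_subset_range p hy)

lemma measurableSet_target (p : M) : MeasurableSet (extChartAt (𝓡∂ n) p).target := by
  rw [extChartAt_target]
  exact ((𝓡∂ n).isClosed_range.measurableSet).inter
    ((chartAt _ p).open_target.preimage (𝓡∂ n).continuous_symm).measurableSet |> fun h => by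
      rwa [inter_comm] at h

variable [IsManifold (𝓡∂ n) ∞ M]

instance isManifold_one : IsManifold (𝓡∂ n) 1 M := .of_le (n := ∞) (by norm_cast)

/-- The coordinate vector field `∂ᵢ` of the chart around `p`, as a section over the chart domain. -/
def coordVec (p x : M) (i : Fin n) : TangentSpace (𝓡∂ n) x :=
  (trivializationAt (E n) (TangentSpace (𝓡∂ n)) p).symmL ℝ x (stdVec i)

/-- Both sides apply the derivative of the inverse chart. The left one is what the coordinate
formulas use; the right one is a section over the chart domain, whose smoothness is known from the
trivialization. -/
lemma frame_eq_coordVec {p : M} {y : E n} (hy : y ∈ (extChartAt (𝓡∂ n) p).target) (i : Fin n) :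
    frame p y i = coordVec p ((extChartAt (𝓡∂ n) p).symm y) i := by
  have hx : (extChartAt (𝓡∂ n) p).symm y ∈ (chartAt (EuclideanHalfSpace n) p).source := by
    rw [← extChartAt_source (𝓡∂ n)]
    exact (extChartAt (𝓡∂ n) p).map_target hy
  rw [coordVec, TangentBundle.symmL_trivializationAt hx, (extChartAt (𝓡∂ n) p).right_inv hy]
  rfl

lemma contMDiffOn_coordVec (p : M) (i : Fin n) :
    ContMDiffOn (𝓡∂ n) ((𝓡∂ n).prod 𝓘(ℝ, E n)) ∞
      (fun x => TotalSpace.mk' (E n) x (coordVec p x i)) (extChartAt (𝓡∂ n) p).source := by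
  have h := (trivializationAt (E n) (TangentSpace (𝓡∂ n)) p).contMDiffOn_localFrame_baseSet
    (I := 𝓡∂ n) (n := ∞) (EuclideanSpace.basisFun (Fin n) ℝ).toBasis i
  have hs : (extChartAt (𝓡∂ n) p).source
    = (trivializationAt (E n) (TangentSpace (𝓡∂ n)) p).baseSet := by
    rw [extChartAt_source, TangentBundle.trivializationAt_baseSet]
  rw [hs]
  refine h.congr fun x hx => ?_
  rw [Trivialization.localFrame_apply_of_mem_baseSet _ _ hx]
  simp [coordVec, Trivialization.basisAt, stdVec, Trivialization.symmL_apply _ hx]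

lemma contDiffOn_comp0 {V : M → ℝ} (hV : ContMDiff (𝓡∂ n) 𝓘(ℝ, ℝ) ∞ V) (p : M) :
    ContDiffOn ℝ ∞ (comp0 V p) (extChartAt (𝓡∂ n) p).target := by
  rw [← contMDiffOn_iff_contDiffOn]
  exact hV.comp_contMDiffOn (contMDiffOn_extChartAt_symm p)

lemma contDiffOn_comp1 {β : OneForm n M} (hβ : SmoothOneForm β) (p : M) (i : Fin n) :
    ContDiffOn ℝ ∞ (fun y => comp1 β p y i) (extChartAt (𝓡∂ n) p).target := by
  rw [← contMDiffOn_iff_contDiffOn]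
  have h1 : ContMDiffOn (𝓡∂ n) 𝓘(ℝ, ℝ) ∞ (fun x => β x (coordVec p x i))
      (extChartAt (𝓡∂ n) p).source := by
    have := (hβ.contMDiffOn (s := (extChartAt (𝓡∂ n) p).source)).clm_bundle_apply
      (contMDiffOn_coordVec p i)
    intro x hx
    have h2 := this x hx
    rw [contMDiffWithinAt_totalSpace] at h2
    exact h2.2
  refine (h1.comp (contMDiffOn_extChartAt_symm p) fun y hy =>
    (extChartAt (𝓡∂ n) p).map_target hy).congr fun y hy => ?_
  simp only [comp1, Function.comp, frame_eq_coordVec hy]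

lemma contDiffOn_gram (g : RMetric n M) (p : M) (i j : Fin n) :
    ContDiffOn ℝ ∞ (fun y => gram g p y i j) (extChartAt (𝓡∂ n) p).target := by
  rw [← contMDiffOn_iff_contDiffOn]
  have h1 : ContMDiffOn (𝓡∂ n) 𝓘(ℝ, ℝ) ∞
      (fun x => g.inner x (coordVec p x i) (coordVec p x j)) (extChartAt (𝓡∂ n) p).source := by
    have := (g.contMDiff.contMDiffOn (s := (extChartAt (𝓡∂ n) p).source)).clm_bundle_apply₂
      (F₃ := ℝ) (E₃ := Bundle.Trivial M ℝ)
      (contMDiffOn_coordVec p i) (contMDiffOn_coordVec p j)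
    intro x hx
    have h2 := this x hx
    rw [contMDiffWithinAt_totalSpace] at h2
    exact h2.2
  refine (h1.comp (contMDiffOn_extChartAt_symm p) fun y hy =>
    (extChartAt (𝓡∂ n) p).map_target hy).congr fun y hy => ?_
  simp only [gram, Function.comp, frame_eq_coordVec hy]

lemma smoothOneForm_smul {ρ : M → ℝ} (hρ : ContMDiff (𝓡∂ n) 𝓘(ℝ, ℝ) ∞ ρ) {β : OneForm n M}
    (hβ : SmoothOneForm β) : SmoothOneForm (fun x => ρ x • β x) :=
  hρ.smul_section hβ

/-- The tangent space at `x` is identified with the model space through the preferred chart at `x`,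
so the derivative of its inverse is the identity there. Chart components at `coord x` are therefore
values on `baseVec`. -/
lemma frame_coord (x : M) (i : Fin n) : (frame x (coord x) i : E n) = stdVec i := by
  have h := mfderivWithin_range_extChartAt_symm (I := 𝓡∂ n) (x := x)
  have := congrArg (fun L : E n →L[ℝ] E n => L (stdVec i)) h
  exact this

lemma symm_coord (x : M) : (extChartAt (𝓡∂ n) x).symm (coord x) = x := extChartAt_to_inv x

lemma coord_mem_target (x : M) : coord x ∈ (extChartAt (𝓡∂ n) x).target :=
  mem_extChartAt_target x

lemma comp1_coord (β : OneForm n M) (x : M) (i : Fin n) :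
    comp1 β x (coord x) i = β x (baseVec x i) := by
  -- The type of the vector depends on its base point, which equals `x` only propositionally; a free
  -- base point `x'` allows substitution.
  have h : ∀ x', x' = x → ∀ v : E n, v = stdVec i →
    β x' (v : TangentSpace (𝓡∂ n) x') = β x (baseVec x i) := by
    rintro _ rfl _ rfl; rfl
  exact h _ (symm_coord x) _ (frame_coord x i)

lemma comp2_coord (h : TwoTensor n M) (x : M) (i j : Fin n) :
    comp2 h x (coord x) i j = h x (baseVec x i) (baseVec x j) := by
  have h : ∀ x', x' = x → ∀ v w : E n, v = stdVec i → w = stdVec j →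
    h x' (v : TangentSpace (𝓡∂ n) x') (w : TangentSpace (𝓡∂ n) x')
      = h x (baseVec x i) (baseVec x j) := by
    rintro _ rfl _ _ rfl rfl; rfl
  exact h _ (symm_coord x) _ _ (frame_coord x i) (frame_coord x j)

lemma gram_coord (g : RMetric n M) (x : M) (i j : Fin n) :
    gram g x (coord x) i j = g.inner x (baseVec x i) (baseVec x j) :=
  comp2_coord g.inner x i j

lemma comp0_coord (V : M → ℝ) (x : M) : comp0 (n := n) V x (coord x) = V x := by
  rw [comp0, symm_coord]

lemma comp1_dfun {φ : M → ℝ} (hφ : ContMDiff (𝓡∂ n) 𝓘(ℝ, ℝ) ∞ φ) {p : M} {y : E n}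
    (hy : y ∈ (extChartAt (𝓡∂ n) p).target) (i : Fin n) :
    comp1 (dfun φ) p y i = pderiv (range (𝓡∂ n)) (comp0 φ p) y i := by
  have h := mfderiv_comp_mfderivWithin (I := 𝓘(ℝ, E n)) (I' := 𝓡∂ n) (I'' := 𝓘(ℝ, ℝ))
    (g := φ) (f := (extChartAt (𝓡∂ n) p).symm) (s := range (𝓡∂ n)) y
    (hφ.mdifferentiable (by simp) _) (mdifferentiableWithinAt_extChartAt_symm hy)
    (uniqueDiffWithinAt_range hy).uniqueMDiffWithinAt
  rw [mfderivWithin_eq_fderivWithin] at h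
  have := congrArg (fun L : E n →L[ℝ] ℝ => L (stdVec i)) h
  exact this.symm

lemma target_mem_nhdsWithin_range {p : M} {y : E n} (hy : y ∈ (extChartAt (𝓡∂ n) p).target) :
    (extChartAt (𝓡∂ n) p).target ∈ 𝓝[range (𝓡∂ n)] y := extChartAt_target_mem_nhdsWithin_of_mem hy

lemma differentiableWithinAt_range {f : E n → ℝ} {p : M}
    (hf : ContDiffOn ℝ ∞ f (extChartAt (𝓡∂ n) p).target) {y : E n}
    (hy : y ∈ (extChartAt (𝓡∂ n) p).target) : DifferentiableWithinAt ℝ f (range (𝓡∂ n)) y :=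
  ((hf.differentiableOn (by simp)) y hy).mono_of_mem_nhdsWithin (target_mem_nhdsWithin_range hy)

lemma continuousOn_pderiv {f : E n → ℝ} {p : M}
    (hf : ContDiffOn ℝ ∞ f (extChartAt (𝓡∂ n) p).target) (i : Fin n) :
    ContinuousOn (fun y => pderiv (range (𝓡∂ n)) f y i) (extChartAt (𝓡∂ n) p).target := by
  intro y hy
  have h : ContDiffWithinAt ℝ ∞ f (range (𝓡∂ n)) y :=
    (hf y hy).mono_of_mem_nhdsWithin (target_mem_nhdsWithin_range hy)
  have h2 := (h.fderivWithin_right (m := 0) uniqueDiffOn_range (by simp)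
    (extChartAt_target_subset_range p hy)).continuousWithinAt
  exact (h2.clm_apply continuousWithinAt_const).mono (extChartAt_target_subset_range p)

lemma dfun_baseVec {φ : M → ℝ} (hφ : ContMDiff (𝓡∂ n) 𝓘(ℝ, ℝ) ∞ φ) (x : M) (i : Fin n) :
    dfun φ x (baseVec x i) = pderiv (range (𝓡∂ n)) (comp0 φ x) (coord x) i := by
  rw [← comp1_dfun hφ (coord_mem_target x), comp1_coord]

end Frame

/-! ### Invariance of contractions under a change of basis -/

open Matrix in
-- The double sum is `b ⬝ᵥ (G⁻¹ *ᵥ d)`; the factors of `F` in the vectors cancel against those in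
-- the inverse of the congruent matrix.
lemma sum_sum_inv_congr {ι : Type*} [Fintype ι] [DecidableEq ι] (F G : Matrix ι ι ℝ)
    (hF : IsUnit F.det) (b d : ι → ℝ) :
    ∑ i, ∑ j, (Fᵀ * G * F)⁻¹ i j * (Fᵀ *ᵥ b) i * (Fᵀ *ᵥ d) j
      = ∑ i, ∑ j, G⁻¹ i j * b i * d j := by
  have key : ∀ (A : Matrix ι ι ℝ) (b d : ι → ℝ), ∑ i, ∑ j, A i j * b i * d j = b ⬝ᵥ (A *ᵥ d) := by
    intro A b d
    simp only [dotProduct, mulVec, Finset.mul_sum]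
    exact Finset.sum_congr rfl fun i _ => Finset.sum_congr rfl fun j _ => by ring
  have hF' : IsUnit Fᵀ.det := by rwa [det_transpose]
  rw [key, key, Matrix.mul_inv_rev, Matrix.mul_inv_rev, mulVec_transpose, ← dotProduct_mulVec, mulVec_mulVec,
    mulVec_mulVec]
  congr 2
  rw [show F * (F⁻¹ * (G⁻¹ * Fᵀ⁻¹)) * Fᵀ = (F * F⁻¹) * G⁻¹ * (Fᵀ⁻¹ * Fᵀ) by
    simp only [Matrix.mul_assoc], mul_nonsing_inv _ hF, nonsing_inv_mul _ hF',
    Matrix.one_mul, Matrix.mul_one]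

open Matrix in
-- The fourfold sum is the trace of `Hᵀ * (A * H * Aᵀ)`. After the change of basis, all factors of
-- `F` cancel except an outer conjugation, which the trace does not see.
lemma sum_sum_inv_inv_congr {ι : Type*} [Fintype ι] [DecidableEq ι] (F G H : Matrix ι ι ℝ)
    (hF : IsUnit F.det) :
    ∑ i, ∑ j, ∑ k, ∑ l, (Fᵀ * G * F)⁻¹ i k * (Fᵀ * G * F)⁻¹ j l * (Fᵀ * H * F) i j
        * (Fᵀ * H * F) k l
      = ∑ i, ∑ j, ∑ k, ∑ l, G⁻¹ i k * G⁻¹ j l * H i j * H k l := by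
  have key : ∀ (A H : Matrix ι ι ℝ), ∑ i, ∑ j, ∑ k, ∑ l, A i k * A j l * H i j * H k l
      = (Hᵀ * (A * H * Aᵀ)).trace := by
    intro A H
    simp only [Matrix.trace, Matrix.diag, Matrix.mul_apply, Matrix.transpose_apply,
      Finset.mul_sum, Finset.sum_mul]
    rw [Finset.sum_comm]
    refine Finset.sum_congr rfl fun i _ => Finset.sum_congr rfl fun j _ => ?_
    rw [Finset.sum_comm]
    exact Finset.sum_congr rfl fun i _ => Finset.sum_congr rfl fun j _ => by ring
  have hF' : IsUnit Fᵀ.det := by rwa [det_transpose]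
  rw [key, key]
  set A := G⁻¹ with hA
  have hinv : (Fᵀ * G * F)⁻¹ = F⁻¹ * A * Fᵀ⁻¹ := by
    rw [Matrix.mul_inv_rev, Matrix.mul_inv_rev, Matrix.mul_assoc]
  rw [hinv]
  have e1 : (F⁻¹ * A * Fᵀ⁻¹)ᵀ = F⁻¹ * Aᵀ * Fᵀ⁻¹ := by
    simp only [transpose_mul, transpose_nonsing_inv, transpose_transpose, Matrix.mul_assoc]
  have e2 : (Fᵀ * H * F)ᵀ = Fᵀ * Hᵀ * F := by
    simp only [transpose_mul, transpose_transpose, Matrix.mul_assoc]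
  rw [e1, e2]
  have e3 : Fᵀ * Hᵀ * F * (F⁻¹ * A * Fᵀ⁻¹ * (Fᵀ * H * F) * (F⁻¹ * Aᵀ * Fᵀ⁻¹))
      = Fᵀ * (Hᵀ * ((F * F⁻¹) * (A * ((Fᵀ⁻¹ * Fᵀ) * (H * ((F * F⁻¹) * Aᵀ)))))) * Fᵀ⁻¹ := by
    simp only [Matrix.mul_assoc]
  rw [e3, mul_nonsing_inv _ hF, nonsing_inv_mul _ hF', Matrix.one_mul, Matrix.one_mul,
    Matrix.one_mul, Matrix.trace_mul_comm, ← Matrix.mul_assoc, nonsing_inv_mul _ hF',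
    Matrix.one_mul, Matrix.mul_assoc]

open Matrix in
open scoped MatrixOrder in
-- Factor `A = Bᵀ * B` and take `F = B⁻¹`. This is the source of orthonormal frames.
lemma exists_transpose_mul_mul_eq_one {ι : Type*} [Fintype ι] [DecidableEq ι] {A : Matrix ι ι ℝ}
    (hA : A.PosDef) : ∃ F : Matrix ι ι ℝ, IsUnit F.det ∧ Fᵀ * A * F = 1 := by
  obtain ⟨B, hB⟩ := CStarAlgebra.nonneg_iff_eq_star_mul_self.1 hA.posSemidef.nonneg
  have hB' : A = Bᵀ * B := hB
  have hdet : IsUnit B.det := by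
    have h := hA.det_pos.ne'
    rw [hB', det_mul, det_transpose] at h
    exact isUnit_iff_ne_zero.2 (left_ne_zero_of_mul h)
  refine ⟨B⁻¹, by rwa [det_nonsing_inv, isUnit_ringInverse], ?_⟩
  have hdet' : IsUnit Bᵀ.det := by rwa [det_transpose]
  rw [hB', transpose_nonsing_inv, Matrix.mul_assoc, Matrix.mul_assoc, mul_nonsing_inv _ hdet,
    Matrix.mul_one, nonsing_inv_mul _ hdet']

/-! ### Pointwise norms of tensors and orthonormal frames -/

section Pointwise

variable {n : ℕ} [NeZero n] {M : Type*} [TopologicalSpace M]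
  [ChartedSpace (EuclideanHalfSpace n) M]

/-- The matrix whose columns are the components of the vectors `f i`. -/
def frameMatrix (f : Fin n → E n) : Matrix (Fin n) (Fin n) ℝ := fun j i => f i j

lemma sum_smul_apply (c : Fin n → ℝ) (f : Fin n → E n) (j : Fin n) :
    (∑ i, c i • f i) j = ∑ i, c i * f i j := by
  simp

lemma eq_sum_baseVec (x : M) (v : TangentSpace (𝓡∂ n) x) :
    v = ∑ j, (show E n from v) j • baseVec x j := (sum_smul_stdVec (n := n) v).symm

lemma oneForm_apply_eq_sum {x : M} (β : TangentSpace (𝓡∂ n) x →L[ℝ] ℝ)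
    (v : TangentSpace (𝓡∂ n) x) : β v = ∑ j, (show E n from v) j * β (baseVec x j) := by
  conv_lhs => rw [eq_sum_baseVec x v]
  simp [map_sum]

lemma twoTensor_apply_eq_sum {x : M}
    (h : TangentSpace (𝓡∂ n) x →L[ℝ] TangentSpace (𝓡∂ n) x →L[ℝ] ℝ)
    (v w : TangentSpace (𝓡∂ n) x) :
    h v w = ∑ i, ∑ j, (show E n from v) i * (show E n from w) j * h (baseVec x i) (baseVec x j) := by
  rw [oneForm_apply_eq_sum (h v) w, Finset.sum_comm]
  refine Finset.sum_congr rfl fun j _ => ?_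
  conv_lhs => rw [eq_sum_baseVec x v]
  simp only [map_sum, map_smul, sum_apply, smul_apply, smul_eq_mul,
    Finset.mul_sum]
  exact Finset.sum_congr rfl fun i _ => by ring

open Matrix in
lemma matrix_twoTensor {x : M}
    (h : TangentSpace (𝓡∂ n) x →L[ℝ] TangentSpace (𝓡∂ n) x →L[ℝ] ℝ)
    (f : Fin n → TangentSpace (𝓡∂ n) x) :
    (Matrix.of fun i j => h (f i) (f j)) = (frameMatrix f)ᵀ *
      (Matrix.of fun i j => h (baseVec x i) (baseVec x j)) * frameMatrix f := by
  ext i j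
  simp only [Matrix.of_apply, Matrix.mul_apply, Matrix.transpose_apply, frameMatrix,
    Finset.sum_mul]
  rw [twoTensor_apply_eq_sum, Finset.sum_comm]
  exact Finset.sum_congr rfl fun i _ => Finset.sum_congr rfl fun j _ => by ring

open Matrix in
lemma vec_oneForm {x : M} (β : TangentSpace (𝓡∂ n) x →L[ℝ] ℝ)
    (f : Fin n → TangentSpace (𝓡∂ n) x) :
    (fun i => β (f i)) = (frameMatrix f)ᵀ *ᵥ (fun i => β (baseVec x i)) := by
  ext i
  rw [oneForm_apply_eq_sum]
  rfl

variable [IsManifold (𝓡∂ n) ∞ M]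

lemma gram_coord_eq (g : RMetric n M) (x : M) :
    gram g x (coord x) = Matrix.of fun i j => g.inner x (baseVec x i) (baseVec x j) := by
  ext i j; exact gram_coord g x i j

/-- The definition of `inner1` uses the preferred chart at `x`, which varies with `x`. Computing in
any frame gives access to a fixed chart, where regularity in `x` is visible, and to orthonormal
frames, where inequalities are elementary. -/
lemma inner1_eq_of_frame (g : RMetric n M) {x : M} (β δ : TangentSpace (𝓡∂ n) x →L[ℝ] ℝ)
    (f : Fin n → TangentSpace (𝓡∂ n) x) (hf : IsUnit (frameMatrix f).det) :
    inner1 g x β δ = ∑ i, ∑ j,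
      (Matrix.of fun i j => g.inner x (f i) (f j))⁻¹ i j * β (f i) * δ (f j) := by
  rw [matrix_twoTensor, inner1, gInv, gram_coord_eq]
  have h1 := fun i => congrFun (vec_oneForm β f) i
  have h2 := fun i => congrFun (vec_oneForm δ f) i
  simp only [h1, h2]
  exact (sum_sum_inv_congr _ _ hf _ _).symm

lemma normSq2_eq_of_frame (g : RMetric n M) {x : M}
    (h : TangentSpace (𝓡∂ n) x →L[ℝ] TangentSpace (𝓡∂ n) x →L[ℝ] ℝ)
    (f : Fin n → TangentSpace (𝓡∂ n) x) (hf : IsUnit (frameMatrix f).det) :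
    normSq2 g x h = ∑ i, ∑ j, ∑ k, ∑ l,
      (Matrix.of fun i j => g.inner x (f i) (f j))⁻¹ i k *
      (Matrix.of fun i j => g.inner x (f i) (f j))⁻¹ j l * h (f i) (f j) * h (f k) (f l) := by
  rw [matrix_twoTensor, normSq2, gInv, gram_coord_eq]
  have h1 := fun i j => congrFun (congrFun (matrix_twoTensor h f) i) j
  simp only [Matrix.of_apply] at h1
  simp only [h1]
  exact (sum_sum_inv_inv_congr _ _ _ hf).symm

lemma posDef_gram_of_frame (g : RMetric n M) {x : M} (f : Fin n → TangentSpace (𝓡∂ n) x)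
    (hf : IsUnit (frameMatrix f).det) :
    (Matrix.of fun i j => g.inner x (f i) (f j)).PosDef := by
  refine Matrix.PosDef.of_dotProduct_mulVec_pos ?_ fun c hc => ?_
  · ext i j; simp [g.symm x (f i) (f j)]
  · have e : (star c ⬝ᵥ ((Matrix.of fun i j => g.inner x (f i) (f j)).mulVec c))
        = g.inner x (∑ i, c i • f i) (∑ i, c i • f i) := by
      simp [dotProduct, Matrix.mulVec, map_sum, Finset.mul_sum]
      rw [Finset.sum_comm]
      refine Finset.sum_congr rfl fun i _ => Finset.sum_congr rfl fun j _ => by ring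
    rw [e]
    refine g.pos x _ fun h0 => hc ?_
    have h1 : (frameMatrix f).mulVec c = 0 := by
      ext j
      have := congrArg (fun v : E n => v j) h0
      simp only [Matrix.mulVec, dotProduct, frameMatrix]
      refine Eq.trans ?_ ((sum_smul_apply c f j).symm.trans this)
      exact Finset.sum_congr rfl fun i _ => mul_comm _ _
    have := congrArg ((frameMatrix f)⁻¹.mulVec) h1
    rwa [Matrix.mulVec_mulVec, Matrix.nonsing_inv_mul _ hf, Matrix.one_mulVec,
      Matrix.mulVec_zero] at this

lemma frameMatrix_baseVec (x : M) : frameMatrix (fun i => (baseVec x i : E n)) = 1 := by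
  ext i j
  simp [frameMatrix, baseVec, stdVec_apply, Matrix.one_apply]

/-- In such a frame the norms are sums of squares, so that the pointwise inequalities below reduce
to inequalities between real numbers. -/
lemma exists_orthonormal (g : RMetric n M) (x : M) :
    ∃ f : Fin n → TangentSpace (𝓡∂ n) x,
      (∀ i j, g.inner x (f i) (f j) = if i = j then 1 else 0) ∧
      (∀ β δ, inner1 g x β δ = ∑ i, β (f i) * δ (f i)) ∧
      (∀ h, normSq2 g x h = ∑ i, ∑ j, h (f i) (f j) ^ 2) := by
  have hb : IsUnit (frameMatrix (fun i => (baseVec x i : E n))).det := by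
    rw [frameMatrix_baseVec]; simp
  obtain ⟨F, hF, hF1⟩ := exists_transpose_mul_mul_eq_one
    (posDef_gram_of_frame g (fun i => baseVec x i) hb)
  have hmat : frameMatrix (fun i => (∑ j, F j i • stdVec j : E n)) = F := by
    ext i j
    simp [frameMatrix, stdVec_apply]
  let f : Fin n → TangentSpace (𝓡∂ n) x := fun i => ∑ j, F j i • baseVec x j
  have hfF : frameMatrix f = F := hmat
  have hgram : (Matrix.of fun i j => g.inner x (f i) (f j)) = 1 := by
    rw [matrix_twoTensor, hfF, hF1]
  have hf : IsUnit (frameMatrix f).det := by rwa [hfF]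
  refine ⟨f, fun i j => ?_, fun β δ => ?_, fun h => ?_⟩
  · simpa [Matrix.one_apply] using congrFun (congrFun hgram i) j
  · rw [inner1_eq_of_frame g β δ f hf, hgram]
    simp [Matrix.one_apply]
  · rw [normSq2_eq_of_frame g h f hf, hgram]
    simp [Matrix.one_apply, sq]

/-- The derivative of the inverse chart is invertible up to the boundary; the matrix of its inverse
provides an inverse determinant. -/
lemma isUnit_frameMatrix_frame {p : M} {y : E n} (hy : y ∈ (extChartAt (𝓡∂ n) p).target) :
    IsUnit (frameMatrix (fun i => (frame p y i : E n))).det := by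
  obtain ⟨e, he⟩ := isInvertible_mfderivWithin_extChartAt_symm (I := 𝓡∂ n) hy
  let e' : E n ≃L[ℝ] E n := e
  have h1 : ∀ i, (frame p y i : E n) = e' (stdVec i) := fun i => by
    change mfderivWithin 𝓘(ℝ, E n) (𝓡∂ n) (extChartAt (𝓡∂ n) p).symm (range (𝓡∂ n)) y _ = _
    rw [← he]; rfl
  refine isUnit_iff_exists_inv.2 ⟨(frameMatrix fun i => e'.symm (stdVec i)).det, ?_⟩
  rw [← Matrix.det_mul]
  have : frameMatrix (fun i => (frame p y i : E n)) * frameMatrix (fun i => e'.symm (stdVec i))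
      = 1 := by
    ext i j
    have h2 : e' (∑ k, (e'.symm (stdVec j)) k • stdVec k) = stdVec j := by
      rw [sum_smul_stdVec, ContinuousLinearEquiv.apply_symm_apply]
    have h3 := congrArg (fun v : E n => v i) h2
    simp only [map_sum, map_smul, stdVec_apply, ← h1] at h3
    simp only [Matrix.mul_apply, frameMatrix, Matrix.one_apply]
    refine Eq.trans ?_ ((sum_smul_apply _ (fun k => (frame p y k : E n)) i).symm.trans h3)
    exact Finset.sum_congr rfl fun k _ => mul_comm _ _
  rw [this, Matrix.det_one]

lemma posDef_gram (g : RMetric n M) {p : M} {y : E n} (hy : y ∈ (extChartAt (𝓡∂ n) p).target) :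
    (gram g p y).PosDef :=
  posDef_gram_of_frame g (frame p y) (isUnit_frameMatrix_frame hy)

lemma gram_symm (g : RMetric n M) (p : M) (y : E n) (i j : Fin n) :
    gram g p y i j = gram g p y j i := g.symm _ _ _

lemma inner1_chart (g : RMetric n M) {p : M} {y : E n} (hy : y ∈ (extChartAt (𝓡∂ n) p).target)
    (β δ : OneForm n M) :
    inner1 g ((extChartAt (𝓡∂ n) p).symm y) (β _) (δ _)
      = ∑ i, ∑ j, (gram g p y)⁻¹ i j * comp1 β p y i * comp1 δ p y j :=
  inner1_eq_of_frame g _ _ (frame p y) (isUnit_frameMatrix_frame hy)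

lemma inner1_self_nonneg (g : RMetric n M) (x : M) (β : TangentSpace (𝓡∂ n) x →L[ℝ] ℝ) :
    0 ≤ inner1 g x β β := by
  obtain ⟨f, -, h1, -⟩ := exists_orthonormal g x
  rw [h1]
  exact Finset.sum_nonneg fun i _ => mul_self_nonneg _

lemma normSq2_nonneg (g : RMetric n M) (x : M)
    (h : TangentSpace (𝓡∂ n) x →L[ℝ] TangentSpace (𝓡∂ n) x →L[ℝ] ℝ) : 0 ≤ normSq2 g x h := by
  obtain ⟨f, -, -, h1⟩ := exists_orthonormal g x
  rw [h1]
  positivity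

lemma inner1_sq_le (g : RMetric n M) (x : M) (β δ : TangentSpace (𝓡∂ n) x →L[ℝ] ℝ) :
    inner1 g x β δ ^ 2 ≤ inner1 g x β β * inner1 g x δ δ := by
  obtain ⟨f, -, h1, -⟩ := exists_orthonormal g x
  simp only [h1, ← sq]
  exact Finset.sum_mul_sq_le_sq_mul_sq _ _ _

lemma inner1_add_le (g : RMetric n M) (x : M) (β δ : TangentSpace (𝓡∂ n) x →L[ℝ] ℝ) :
    inner1 g x (β + δ) (β + δ) ≤ 2 * inner1 g x β β + 2 * inner1 g x δ δ := by
  obtain ⟨f, -, h1, -⟩ := exists_orthonormal g x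
  simp only [h1, Finset.mul_sum, ← Finset.sum_add_distrib]
  refine Finset.sum_le_sum fun i _ => ?_
  simp only [add_apply]
  nlinarith [sq_nonneg (β (f i) - δ (f i))]

lemma normSq2_add_le (g : RMetric n M) (x : M)
    (h k : TangentSpace (𝓡∂ n) x →L[ℝ] TangentSpace (𝓡∂ n) x →L[ℝ] ℝ) :
    normSq2 g x (h + k) ≤ 2 * normSq2 g x h + 2 * normSq2 g x k := by
  obtain ⟨f, -, -, h1⟩ := exists_orthonormal g x
  simp only [h1, Finset.mul_sum, ← Finset.sum_add_distrib]
  refine Finset.sum_le_sum fun i _ => Finset.sum_le_sum fun j _ => ?_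
  simp only [add_apply]
  nlinarith [sq_nonneg (h (f i) (f j) - k (f i) (f j))]

lemma inner1_smul_smul (g : RMetric n M) (x : M) (β δ : TangentSpace (𝓡∂ n) x →L[ℝ] ℝ) (c d : ℝ) :
    inner1 g x (c • β) (d • δ) = c * d * inner1 g x β δ := by
  simp only [inner1, smul_apply, smul_eq_mul, Finset.mul_sum]
  exact Finset.sum_congr rfl fun i _ => Finset.sum_congr rfl fun j _ => by ring

lemma inner1_sub_right (g : RMetric n M) (x : M) (β δ ε : TangentSpace (𝓡∂ n) x →L[ℝ] ℝ) :
    inner1 g x β (δ - ε) = inner1 g x β δ - inner1 g x β ε := by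
  simp only [inner1, sub_apply, ← Finset.sum_sub_distrib, mul_sub]

lemma normSq2_smul (g : RMetric n M) (x : M)
    (h : TangentSpace (𝓡∂ n) x →L[ℝ] TangentSpace (𝓡∂ n) x →L[ℝ] ℝ) (c : ℝ) :
    normSq2 g x (c • h) = c ^ 2 * normSq2 g x h := by
  simp only [normSq2, smul_apply, smul_eq_mul, Finset.mul_sum]
  exact Finset.sum_congr rfl fun i _ => Finset.sum_congr rfl fun j _ =>
    Finset.sum_congr rfl fun k _ => Finset.sum_congr rfl fun l _ => by ring

lemma normSq2_smulRight (g : RMetric n M) (x : M) (β δ : TangentSpace (𝓡∂ n) x →L[ℝ] ℝ) :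
    normSq2 g x (β.smulRight δ) = inner1 g x β β * inner1 g x δ δ := by
  obtain ⟨f, -, h1, h2⟩ := exists_orthonormal g x
  simp only [h1, h2, Finset.sum_mul_sum]
  refine Finset.sum_congr rfl fun i _ => Finset.sum_congr rfl fun j _ => ?_
  simp only [ContinuousLinearMap.smulRight_apply, smul_apply, smul_eq_mul]
  ring

lemma normSq2_metric (g : RMetric n M) (x : M) : normSq2 g x (g.inner x) = n := by
  obtain ⟨f, h0, -, h2⟩ := exists_orthonormal g x
  simp [h2, h0]

end Pointwise

/-! ### Conformal change of the coordinate formulas -/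

section ConformalCoord

variable {n : ℕ} {S : Set (E n)} {γ : E n → Matrix (Fin n) (Fin n) ℝ} {P : E n → ℝ} {y : E n}

lemma pderiv_mul (hS : UniqueDiffWithinAt ℝ S y) {f h : E n → ℝ}
    (hf : DifferentiableWithinAt ℝ f S y) (hh : DifferentiableWithinAt ℝ h S y) (i : Fin n) :
    pderiv S (fun z => f z * h z) y i = pderiv S f y i * h y + f y * pderiv S h y i := by
  simp only [pderiv]
  rw [fderivWithin_fun_mul hS hf hh]
  simp only [add_apply, smul_apply, smul_eq_mul]
  ring

lemma inv_smul_matrix (hP : P y ≠ 0) (hdet : IsUnit (γ y).det) :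
    (P y • γ y)⁻¹ = (P y)⁻¹ • (γ y)⁻¹ := by
  have := Matrix.inv_smul' (γ y) (Units.mk0 (P y) hP) hdet
  simpa [Units.smul_def] using this

lemma sum_inv_mul (hdet : IsUnit (γ y).det) (hsymm : ∀ i j, γ y i j = γ y j i) (l j : Fin n) :
    ∑ m, (γ y)⁻¹ l m * γ y j m = if l = j then 1 else 0 := by
  have h := congrFun (congrFun (Matrix.nonsing_inv_mul (γ y) hdet) l) j
  rw [Matrix.mul_apply, Matrix.one_apply] at h
  rw [← h]
  exact Finset.sum_congr rfl fun m _ => by rw [hsymm j m]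

/-- In the product rule for `P • γ` the terms with derivatives of `γ` reproduce the old symbol,
since the factor `P` cancels against the inverse matrix. The terms with derivatives of `P` contract
`γ⁻¹` with `γ` and leave Kronecker deltas. -/
lemma christoffel_conformal (hS : UniqueDiffWithinAt ℝ S y)
    (hPd : DifferentiableWithinAt ℝ P S y)
    (hγ : ∀ i j, DifferentiableWithinAt ℝ (fun z => γ z i j) S y) (hP : P y ≠ 0)
    (hdet : IsUnit (γ y).det) (hsymm : ∀ i j, γ y i j = γ y j i) (l i j : Fin n) :
    christoffel S (fun z => P z • γ z) y l i j = christoffel S γ y l i j +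
      (2 * P y)⁻¹ * (pderiv S P y i * (if l = j then 1 else 0)
        + pderiv S P y j * (if l = i then 1 else 0)
        - γ y i j * ∑ m, (γ y)⁻¹ l m * pderiv S P y m) := by
  -- With the deltas written back as contractions of `γ⁻¹` and `γ`, the identity holds term by term
  -- in the summation index.
  rw [← sum_inv_mul hdet hsymm l j, ← sum_inv_mul hdet hsymm l i]
  simp only [christoffel, Matrix.smul_apply, smul_eq_mul]
  rw [inv_smul_matrix hP hdet]
  simp only [Matrix.smul_apply, smul_eq_mul, pderiv_mul hS hPd (hγ _ _), Finset.mul_sum,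
    ← Finset.sum_add_distrib, ← Finset.sum_sub_distrib]
  refine Finset.sum_congr rfl fun m _ => ?_
  field_simp
  ring

lemma lorentz_conformal (hP : P y ≠ 0) (hdet : IsUnit (γ y).det) (a : E n → Fin n → ℝ)
    (l i : Fin n) :
    lorentz S (fun z => P z • γ z) a y l i = (P y)⁻¹ * lorentz S γ a y l i := by
  simp only [lorentz, inv_smul_matrix hP hdet, Matrix.smul_apply, smul_eq_mul, Finset.mul_sum,
    mul_assoc]

/-- A curve `c` run at the rate 1/P has velocity P⁻¹ v and acceleration P⁻² c'' - P⁻³ dP(v) v, the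
right-hand side. The conformal Christoffel symbols contribute a gradient term ½ P⁻³ |v|² ∇P, and
differentiating u = k - P (k' - u') gives -∇u = (k' - u') ∇P - P ∇u'. The two match exactly when
|v|² = 2 P (k' - u'), which is the energy condition `hv`. -/
lemma accel_conformal (hS : UniqueDiffWithinAt ℝ S y)
    (hPd : DifferentiableWithinAt ℝ P S y)
    (hγ : ∀ i j, DifferentiableWithinAt ℝ (fun z => γ z i j) S y) (hP : P y ≠ 0)
    (hdet : IsUnit (γ y).det) (hsymm : ∀ i j, γ y i j = γ y j i) (a : E n → Fin n → ℝ)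
    {u u' : E n → ℝ} {k k' : ℝ} (hu' : DifferentiableWithinAt ℝ u' S y)
    (hu : ∀ z, u z = k - P z * (k' - u' z)) (v : E n)
    (hv : (1 / 2 : ℝ) * (∑ i, ∑ j, γ y i j * v i * v j) + u y = k) :
    accel S (fun z => P z • γ z) a u' y ((P y)⁻¹ • v) =
      ((P y)⁻¹ ^ 2) • accel S γ a u y v
        - ((P y)⁻¹ ^ 3 * ∑ i, pderiv S P y i * v i) • v := by
  have hdu : ∀ m, pderiv S u y m = - pderiv S P y m * (k' - u' y) + P y * pderiv S u' y m := by
    intro m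
    have h1 : u = fun z => k - P z * (k' - u' z) := funext hu
    have h2 : DifferentiableWithinAt ℝ (fun z => k' - u' z) S y := hu'.const_sub k'
    have h3 := pderiv_mul hS hPd h2 m
    simp only [pderiv] at h3 ⊢
    rw [h1, fderivWithin_const_sub hS, neg_apply, h3, fderivWithin_const_sub hS, neg_apply]
    ring
  ext l
  simp only [accel, PiLp.sub_apply, PiLp.smul_apply, smul_eq_mul]
  simp only [christoffel_conformal hS hPd hγ hP hdet hsymm, lorentz_conformal hP hdet,
    inv_smul_matrix hP hdet, Matrix.smul_apply, smul_eq_mul, hdu]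
  set Q := (P y)⁻¹ with hQ
  set N := ∑ m, (γ y)⁻¹ l m * pderiv S P y m with hN
  set N' := ∑ m, (γ y)⁻¹ l m * pderiv S u' y m with hN'
  set D := ∑ i, pderiv S P y i * v i with hD
  set V := ∑ i, ∑ j, γ y i j * v i * v j with hV
  set C := ∑ i, ∑ j, christoffel S γ y l i j * v i * v j with hC
  set L := ∑ i, lorentz S γ a y l i * v i with hL
  have hQP : Q * P y = 1 := inv_mul_cancel₀ hP
  have e1 : ∑ i, ∑ j, (christoffel S γ y l i j + (2 * P y)⁻¹ * (pderiv S P y i *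
      (if l = j then 1 else 0) + pderiv S P y j * (if l = i then 1 else 0) - γ y i j * N))
        * (Q * v i) * (Q * v j) = Q ^ 2 * C + Q ^ 3 / 2 * (2 * D * v l - V * N) := by
    have a1 : ∀ i j, (christoffel S γ y l i j + (2 * P y)⁻¹ * (pderiv S P y i *
      (if l = j then 1 else 0) + pderiv S P y j * (if l = i then 1 else 0) - γ y i j * N))
        * (Q * v i) * (Q * v j) = Q ^ 2 * (christoffel S γ y l i j * v i * v j)
          + Q ^ 3 / 2 * ((pderiv S P y i * v i) * (if l = j then v j else 0)
            + (pderiv S P y j * v j) * (if l = i then v i else 0) - γ y i j * v i * v j * N) := by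
      intro i j
      rw [mul_inv, ← hQ]
      split_ifs <;> ring
    simp only [a1, Finset.sum_add_distrib, Finset.sum_sub_distrib, ← Finset.mul_sum,
      ← Finset.sum_mul, Finset.sum_ite_eq, Finset.mem_univ, if_true, ← hC, ← hD, ← hV]
    ring
  have e2 : ∑ i, Q * lorentz S γ a y l i * (Q * v i) = Q ^ 2 * L := by
    rw [hL, Finset.mul_sum]
    exact Finset.sum_congr rfl fun i _ => by ring
  have e3 : ∑ m, Q * (γ y)⁻¹ l m * pderiv S u' y m = Q * N' := by
    rw [hN', Finset.mul_sum]
    exact Finset.sum_congr rfl fun i _ => by ring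
  have e4 : ∑ m, (γ y)⁻¹ l m * (-pderiv S P y m * (k' - u' y) + P y * pderiv S u' y m)
      = - N * (k' - u' y) + P y * N' := by
    rw [hN, hN', ← Finset.sum_neg_distrib, Finset.sum_mul, Finset.mul_sum,
      ← Finset.sum_add_distrib]
    exact Finset.sum_congr rfl fun i _ => by ring
  rw [e1, e2, e3, e4]
  have hVu : V = 2 * P y * (k' - u' y) := by rw [hu y] at hv; linarith
  rw [hVu]
  linear_combination (Q ^ 2 * (k' - u' y) * N + Q * N') * hQP

end ConformalCoord

/-! ### Conformal metrics on the manifold and the covariant derivative -/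

section Conformal

variable {n : ℕ} [NeZero n] {M : Type*} [TopologicalSpace M]
  [ChartedSpace (EuclideanHalfSpace n) M] [IsManifold (𝓡∂ n) ∞ M]

/-- The metric `g'` is `ρ g` for a smooth positive function `ρ`. -/
structure IsConformal (g g' : RMetric n M) (ρ : M → ℝ) : Prop where
  smooth : ContMDiff (𝓡∂ n) 𝓘(ℝ, ℝ) ∞ ρ
  pos : ∀ x, 0 < ρ x
  inner_eq : ∀ x, g'.inner x = ρ x • g.inner x

variable {g g' : RMetric n M} {ρ : M → ℝ}

lemma IsConformal.symm (h : IsConformal g g' ρ) : IsConformal g' g (fun x => (ρ x)⁻¹) where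
  smooth x := ((contDiffAt_inv ℝ (h.pos x).ne').contMDiffAt).comp x (h.smooth x)
  pos x := inv_pos.2 (h.pos x)
  inner_eq x := by rw [h.inner_eq, smul_smul, inv_mul_cancel₀ (h.pos x).ne', one_smul]

lemma IsConformal.gram_eq (h : IsConformal g g' ρ) (p : M) :
    gram g' p = fun y => comp0 ρ p y • gram g p y := by
  ext y i j
  simp only [gram, h.inner_eq]
  rfl

lemma IsConformal.gram_inv (h : IsConformal g g' ρ) {p : M} {y : E n}
    (hy : y ∈ (extChartAt (𝓡∂ n) p).target) :
    (gram g' p y)⁻¹ = (comp0 ρ p y)⁻¹ • (gram g p y)⁻¹ := by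
  rw [h.gram_eq]
  exact inv_smul_matrix (h.pos _).ne' (isUnit_iff_ne_zero.2 (posDef_gram g hy).det_pos.ne')

lemma IsConformal.inner1_eq (h : IsConformal g g' ρ) (x : M)
    (β δ : TangentSpace (𝓡∂ n) x →L[ℝ] ℝ) :
    inner1 g' x β δ = (ρ x)⁻¹ * inner1 g x β δ := by
  simp only [inner1, gInv, h.gram_inv (coord_mem_target x), comp0_coord, Matrix.smul_apply,
    smul_eq_mul, Finset.mul_sum, mul_assoc]

lemma IsConformal.normSq2_eq (h : IsConformal g g' ρ) (x : M)
    (k : TangentSpace (𝓡∂ n) x →L[ℝ] TangentSpace (𝓡∂ n) x →L[ℝ] ℝ) :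
    normSq2 g' x k = (ρ x)⁻¹ ^ 2 * normSq2 g x k := by
  simp only [normSq2, gInv, h.gram_inv (coord_mem_target x), comp0_coord, Matrix.smul_apply,
    smul_eq_mul, Finset.mul_sum]
  refine Finset.sum_congr rfl fun i _ => Finset.sum_congr rfl fun j _ =>
    Finset.sum_congr rfl fun k _ => Finset.sum_congr rfl fun l _ => by ring

lemma isUnit_det_gram (g : RMetric n M) {p : M} {y : E n}
    (hy : y ∈ (extChartAt (𝓡∂ n) p).target) : IsUnit (gram g p y).det :=
  isUnit_iff_ne_zero.2 (posDef_gram g hy).det_pos.ne'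

lemma IsConformal.lorentzForce_eq (h : IsConformal g g' ρ) (α : OneForm n M) (x : M)
    (v : TangentSpace (𝓡∂ n) x) :
    lorentzForce g' α x v = (ρ x)⁻¹ • lorentzForce g α x v := by
  simp only [lorentzForce, h.gram_eq, Finset.smul_sum, smul_smul]
  refine Finset.sum_congr rfl fun l _ => ?_
  congr 1
  rw [Finset.mul_sum]
  refine Finset.sum_congr rfl fun i _ => ?_
  rw [lorentz_conformal (by rw [comp0_coord]; exact (h.pos x).ne')
    (isUnit_det_gram g (coord_mem_target x)), comp0_coord, mul_assoc]

lemma twoTensor_ext {x : M} {h k : TangentSpace (𝓡∂ n) x →L[ℝ] TangentSpace (𝓡∂ n) x →L[ℝ] ℝ}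
    (H : ∀ i j, h (baseVec x i) (baseVec x j) = k (baseVec x i) (baseVec x j)) : h = k := by
  ext v w
  rw [twoTensor_apply_eq_sum h, twoTensor_apply_eq_sum k]
  simp only [H]

lemma dcoord_baseVec (x : M) (i j : Fin n) : dcoord x i (baseVec x j) = if i = j then 1 else 0 :=
  stdVec_apply j i

lemma covDeriv_baseVec (g : RMetric n M) (u : OneForm n M) (x : M) (i j : Fin n) :
    covDeriv g u x (baseVec x i) (baseVec x j) =
      pderiv (range (𝓡∂ n)) (fun y => comp1 u x y j) (coord x) i
        - ∑ l, christoffel (range (𝓡∂ n)) (gram g x) (coord x) l i j * u x (baseVec x l) := by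
  simp only [covDeriv, sum_apply, smul_apply,
    ContinuousLinearMap.smulRight_apply, dcoord_baseVec, smul_eq_mul, comp1_coord]
  simp

/-- The zeroth order term in the conformal change of the covariant derivative. -/
def confTerm (g : RMetric n M) (ρ : M → ℝ) (w : OneForm n M) : TwoTensor n M := fun x =>
  (1 / 2 : ℝ) • ((dfun ρ x).smulRight (w x) - (w x).smulRight (dfun ρ x))
    + ((1 / 2 : ℝ) * inner1 g x (dfun ρ x) (w x)) • g.inner x

/-- The factor `ρ` is the one for which `w` and `ρ w` are dual to the same vector field. The product
rule gives dρ ⊗ w, and the conformal Christoffel terms remove its symmetric part, leaving a skew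
term and a multiple of the metric. -/
lemma IsConformal.covDeriv_eq (h : IsConformal g g' ρ) {w : OneForm n M} (hw : SmoothOneForm w)
    (x : M) :
    covDeriv g' (fun x => ρ x • w x) x = ρ x • covDeriv g w x + confTerm g ρ w x := by
  have hx := coord_mem_target (n := n) x
  refine twoTensor_ext fun i j => ?_
  simp only [confTerm, add_apply, smul_apply, sub_apply, ContinuousLinearMap.smulRight_apply,
    covDeriv_baseVec, smul_eq_mul]
  have h1 : (fun y => comp1 (fun x => ρ x • w x) x y j)
      = fun y => comp0 ρ x y * comp1 w x y j := rfl
  have hS := uniqueDiffWithinAt_range hx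
  have hρd := differentiableWithinAt_range (contDiffOn_comp0 h.smooth x) hx
  rw [h1, pderiv_mul hS hρd (differentiableWithinAt_range (contDiffOn_comp1 hw x j) hx),
    h.gram_eq]
  have hρ0 : ρ x ≠ 0 := (h.pos x).ne'
  simp only [christoffel_conformal hS hρd
    (fun i j => differentiableWithinAt_range (contDiffOn_gram g x i j) hx)
    (by rw [comp0_coord]; exact hρ0) (isUnit_det_gram g hx) (gram_symm g x (coord x)),
    ← dfun_baseVec h.smooth, comp0_coord, comp1_coord, ← gram_coord]
  have e : ∑ l, (christoffel (range (𝓡∂ n)) (gram g x) (coord x) l i j + (2 * ρ x)⁻¹ *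
      (dfun ρ x (baseVec x i) * (if l = j then 1 else 0)
        + dfun ρ x (baseVec x j) * (if l = i then 1 else 0)
        - gram g x (coord x) i j * ∑ m, (gram g x (coord x))⁻¹ l m * dfun ρ x (baseVec x m)))
        * (ρ x * w x (baseVec x l))
      = ρ x * ∑ l, christoffel (range (𝓡∂ n)) (gram g x) (coord x) l i j * w x (baseVec x l)
        + 1 / 2 * (dfun ρ x (baseVec x i) * w x (baseVec x j)
        + dfun ρ x (baseVec x j) * w x (baseVec x i)
        - gram g x (coord x) i j * inner1 g x (dfun ρ x) (w x)) := by
    have a1 : ∀ l, (christoffel (range (𝓡∂ n)) (gram g x) (coord x) l i j + (2 * ρ x)⁻¹ *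
      (dfun ρ x (baseVec x i) * (if l = j then 1 else 0)
        + dfun ρ x (baseVec x j) * (if l = i then 1 else 0)
        - gram g x (coord x) i j * ∑ m, (gram g x (coord x))⁻¹ l m * dfun ρ x (baseVec x m)))
        * (ρ x * w x (baseVec x l))
        = ρ x * (christoffel (range (𝓡∂ n)) (gram g x) (coord x) l i j * w x (baseVec x l))
        + 1 / 2 * (dfun ρ x (baseVec x i) * (if l = j then w x (baseVec x l) else 0)
        + dfun ρ x (baseVec x j) * (if l = i then w x (baseVec x l) else 0)
        - gram g x (coord x) i j * ∑ m, (gram g x (coord x))⁻¹ m l * dfun ρ x (baseVec x m)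
          * w x (baseVec x l)) := by
      intro l
      -- The inverse Gram matrix is symmetric; this brings the indices into the order used in
      -- `inner1`.
      have hs : ∀ m, (gram g x (coord x))⁻¹ l m = (gram g x (coord x))⁻¹ m l := fun m => by
        have := (posDef_gram g hx).isHermitian.inv.apply m l
        simpa using this
      simp only [hs, ← Finset.sum_mul]
      split_ifs <;> (field_simp; try ring)
    simp only [a1, Finset.sum_add_distrib, ← Finset.mul_sum, Finset.sum_sub_distrib,
      Finset.sum_ite_eq', Finset.mem_univ, if_true]
    rw [inner1, Finset.sum_comm]
    rfl
  rw [e]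
  ring

end Conformal

/-! ### The Riemannian volume: independence of charts, finiteness, comparison -/

section Volume

variable {n : ℕ} [NeZero n] {M : Type*} [TopologicalSpace M]
  [ChartedSpace (EuclideanHalfSpace n) M] [IsManifold (𝓡∂ n) ∞ M]

lemma coordVec_eq_tangentCoordChange {p x : M} (hx : x ∈ (extChartAt (𝓡∂ n) p).source)
    (i : Fin n) :
    (coordVec p x i : E n) = tangentCoordChange (𝓡∂ n) p x x (stdVec i) := by
  rw [extChartAt_source] at hx
  have h := TangentBundle.symmL_trivializationAt_eq_core (𝕜 := ℝ) (I := 𝓡∂ n) hx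
  exact congrArg (fun L : E n →L[ℝ] E n => L (stdVec i)) h

lemma coordVec_eq_sum {p q x : M} (hp : x ∈ (extChartAt (𝓡∂ n) p).source)
    (hq : x ∈ (extChartAt (𝓡∂ n) q).source) (i : Fin n) :
    coordVec p x i = ∑ j, (tangentCoordChange (𝓡∂ n) p q x (stdVec i)) j • coordVec q x j := by
  have h1 : (coordVec p x i : E n) = tangentCoordChange (𝓡∂ n) q x x
      (tangentCoordChange (𝓡∂ n) p q x (stdVec i)) := by
    rw [coordVec_eq_tangentCoordChange hp,
      tangentCoordChange_comp ⟨⟨hp, hq⟩, mem_extChartAt_source x⟩]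
  have h2 := congrArg (tangentCoordChange (𝓡∂ n) q x x)
    (sum_smul_stdVec (tangentCoordChange (𝓡∂ n) p q x (stdVec i)))
  rw [map_sum] at h2
  simp only [map_smul, ← coordVec_eq_tangentCoordChange hq] at h2
  exact h1.trans h2.symm

lemma gram_extChartAt (g : RMetric n M) {p x : M} (hx : x ∈ (extChartAt (𝓡∂ n) p).source)
    (i j : Fin n) :
    gram g p (extChartAt (𝓡∂ n) p x) i j = g.inner x (coordVec p x i) (coordVec p x j) := by
  simp only [gram, frame_eq_coordVec ((extChartAt (𝓡∂ n) p).map_source hx)]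
  have : ∀ x', x' = x → g.inner x' (coordVec p x' i) (coordVec p x' j)
      = g.inner x (coordVec p x i) (coordVec p x j) := by rintro _ rfl; rfl
  exact this _ ((extChartAt (𝓡∂ n) p).left_inv hx)

lemma det_eq_det_frameMatrix (L : E n →L[ℝ] E n) :
    L.det = (frameMatrix fun i => L (stdVec i)).det := by
  rw [ContinuousLinearMap.det,
    ← LinearMap.det_toMatrix (EuclideanSpace.basisFun (Fin n) ℝ).toBasis]
  congr 1

/-- Gram matrices of two charts are congruent through the coordinate change, so their determinants
differ by the square of its Jacobian. -/
lemma sqrt_det_gram_change (g : RMetric n M) {p q x : M} (hp : x ∈ (extChartAt (𝓡∂ n) p).source)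
    (hq : x ∈ (extChartAt (𝓡∂ n) q).source) :
    Real.sqrt (gram g p (extChartAt (𝓡∂ n) p x)).det
      = |(tangentCoordChange (𝓡∂ n) p q x).det| *
        Real.sqrt (gram g q (extChartAt (𝓡∂ n) q x)).det := by
  set T := frameMatrix fun i => tangentCoordChange (𝓡∂ n) p q x (stdVec i) with hT
  have h : gram g p (extChartAt (𝓡∂ n) p x)
      = T.transpose * gram g q (extChartAt (𝓡∂ n) q x) * T := by
    ext i j
    rw [gram_extChartAt g hp, coordVec_eq_sum hp hq i, coordVec_eq_sum hp hq j]
    simp only [Matrix.mul_apply, Matrix.transpose_apply, Finset.sum_mul, gram_extChartAt g hq,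
      map_sum, map_smul, sum_apply, smul_apply, smul_eq_mul, Finset.mul_sum]
    exact Finset.sum_congr rfl fun k _ => Finset.sum_congr rfl fun l _ => by
      simp only [hT, frameMatrix]; ring
  rw [h, Matrix.det_mul, Matrix.det_mul, Matrix.det_transpose, det_eq_det_frameMatrix, ← hT,
    show T.det * (gram g q (extChartAt (𝓡∂ n) q x)).det * T.det
      = T.det ^ 2 * (gram g q (extChartAt (𝓡∂ n) q x)).det by ring,
    Real.sqrt_mul (sq_nonneg _), Real.sqrt_sq_eq_abs]

variable [MeasurableSpace M]

/-- The Riemannian volume measure of the domain of the chart around `p`. -/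
def chartVol (g : RMetric n M) (p : M) : Measure M :=
  Measure.map (extChartAt (𝓡∂ n) p).symm
    ((volume.restrict (extChartAt (𝓡∂ n) p).target).withDensity
      fun y => ENNReal.ofReal (Real.sqrt (gram g p y).det))

lemma chartVol_le_vol (g : RMetric n M) (p : M) : chartVol g p ≤ vol g :=
  le_iSup (chartVol g) p

variable [BorelSpace M]

lemma aemeasurable_symm (p : M) :
    AEMeasurable (extChartAt (𝓡∂ n) p).symm (volume.restrict (extChartAt (𝓡∂ n) p).target) :=
  (continuousOn_extChartAt_symm p).aemeasurable (measurableSet_target p)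

lemma chartVol_apply (g : RMetric n M) (p : M) {A : Set M} (hA : MeasurableSet A) :
    chartVol g p A = ∫⁻ y in (extChartAt (𝓡∂ n) p).symm ⁻¹' A ∩ (extChartAt (𝓡∂ n) p).target,
      ENNReal.ofReal (Real.sqrt (gram g p y).det) := by
  rw [chartVol, Measure.map_apply_of_aemeasurable
    ((aemeasurable_symm p).mono_ac (withDensity_absolutelyContinuous _ _)) hA,
    withDensity_apply', Measure.restrict_restrict' (measurableSet_target p)]

lemma measurableSet_symm_preimage (p : M) {A : Set M} (hA : MeasurableSet A) :
    MeasurableSet ((extChartAt (𝓡∂ n) p).symm ⁻¹' A ∩ (extChartAt (𝓡∂ n) p).target) := by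
  have h : Measurable ((extChartAt (𝓡∂ n) p).target.domRestrict (extChartAt (𝓡∂ n) p).symm) :=
    (continuousOn_iff_continuous_domRestrict.1 (continuousOn_extChartAt_symm p)).measurable
  have := (measurableSet_target p).subtype_image (h hA)
  rwa [show ((↑) '' ((extChartAt (𝓡∂ n) p).target.domRestrict (extChartAt (𝓡∂ n) p).symm ⁻¹' A))
    = (extChartAt (𝓡∂ n) p).symm ⁻¹' A ∩ (extChartAt (𝓡∂ n) p).target by
      ext y
      constructor
      · rintro ⟨⟨z, hz⟩, h, rfl⟩
        exact ⟨h, hz⟩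
      · rintro ⟨h1, h2⟩
        exact ⟨⟨y, h2⟩, h1, rfl⟩] at this

lemma measurableSet_source (p : M) : MeasurableSet (extChartAt (𝓡∂ n) p).source :=
  (isOpen_extChartAt_source p).measurableSet

/-- Change of variables along the transition map; the Jacobian is absorbed by
`sqrt_det_gram_change`. Derivatives are taken within the half-space, so boundary charts need no
separate treatment. -/
lemma chartVol_congr (g : RMetric n M) (p q : M) {A : Set M} (hA : MeasurableSet A)
    (hp : A ⊆ (extChartAt (𝓡∂ n) p).source) (hq : A ⊆ (extChartAt (𝓡∂ n) q).source) :
    chartVol g p A = chartVol g q A := by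
  rw [chartVol_apply g p hA, chartVol_apply g q hA]
  set B := (extChartAt (𝓡∂ n) p).symm ⁻¹' A ∩ (extChartAt (𝓡∂ n) p).target with hB
  set τ := extChartAt (𝓡∂ n) q ∘ (extChartAt (𝓡∂ n) p).symm with hτ
  have himage : (extChartAt (𝓡∂ n) q).symm ⁻¹' A ∩ (extChartAt (𝓡∂ n) q).target = τ '' B := by
    ext z
    constructor
    · rintro ⟨hz, hz'⟩
      refine ⟨extChartAt (𝓡∂ n) p ((extChartAt (𝓡∂ n) q).symm z), ⟨?_, ?_⟩, ?_⟩
      · rw [mem_preimage, (extChartAt (𝓡∂ n) p).left_inv (hp hz)]; exact hz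
      · exact (extChartAt (𝓡∂ n) p).map_source (hp hz)
      · simp only [hτ, Function.comp]
        rw [(extChartAt (𝓡∂ n) p).left_inv (hp hz), (extChartAt (𝓡∂ n) q).right_inv hz']
    · rintro ⟨y, ⟨hy, hy'⟩, rfl⟩
      refine ⟨?_, (extChartAt (𝓡∂ n) q).map_source (hq hy)⟩
      simp only [hτ, Function.comp, mem_preimage]
      rw [(extChartAt (𝓡∂ n) q).left_inv (hq hy)]; exact hy
  have hd : ∀ y ∈ B, HasFDerivWithinAt τ
      (tangentCoordChange (𝓡∂ n) p q ((extChartAt (𝓡∂ n) p).symm y)) B y := by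
    rintro y ⟨hy, hy'⟩
    have := hasFDerivWithinAt_tangentCoordChange (I := 𝓡∂ n) ⟨hp hy, hq hy⟩
    rw [(extChartAt (𝓡∂ n) p).right_inv hy'] at this
    exact this.mono (inter_subset_right.trans (extChartAt_target_subset_range p))
  have hinj : InjOn τ B := by
    rintro y ⟨hy, hy'⟩ z ⟨hz, hz'⟩ h
    exact (extChartAt (𝓡∂ n) p).symm.injOn hy' hz'
      ((extChartAt (𝓡∂ n) q).injOn (hq hy) (hq hz) h)
  have hBm : MeasurableSet B := measurableSet_symm_preimage p hA
  rw [himage, lintegral_image_eq_lintegral_abs_det_fderiv_mul volume hBm hd hinj]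
  refine setLIntegral_congr_fun hBm ?_
  rintro y ⟨hy, hy'⟩
  have := sqrt_det_gram_change g (hp hy) (hq hy)
  rw [(extChartAt (𝓡∂ n) p).right_inv hy'] at this
  simp only
  rw [this, ENNReal.ofReal_mul (abs_nonneg _)]
  rfl

lemma chartVol_inter_source (g : RMetric n M) (p : M) {A : Set M} (hA : MeasurableSet A) :
    chartVol g p (A ∩ (extChartAt (𝓡∂ n) p).source) = chartVol g p A := by
  rw [chartVol_apply g p hA, chartVol_apply g p (hA.inter (measurableSet_source p))]
  congr 2
  ext y
  simp only [preimage_inter, mem_inter_iff, mem_preimage]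
  exact ⟨fun h => ⟨h.1.1, h.2⟩, fun h => ⟨⟨h.1, (extChartAt (𝓡∂ n) p).map_target h.2⟩, h.2⟩⟩

lemma continuousOn_sqrt_det_gram (g : RMetric n M) (p : M) :
    ContinuousOn (fun y => Real.sqrt (gram g p y).det) (extChartAt (𝓡∂ n) p).target := by
  have h : ContinuousOn (gram g p) (extChartAt (𝓡∂ n) p).target :=
    continuousOn_pi.2 fun i => continuousOn_pi.2 fun j => (contDiffOn_gram g p i j).continuousOn
  rw [continuousOn_iff_continuous_domRestrict] at h ⊢
  exact Real.continuous_sqrt.comp h.matrix_det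

variable [T2Space M] [CompactSpace M]

lemma chartVol_lt_top (g : RMetric n M) {p : M} {K : Set M} (hK : IsCompact K)
    (hKs : K ⊆ (extChartAt (𝓡∂ n) p).source) : chartVol g p K < ⊤ := by
  rw [chartVol_apply g p hK.measurableSet]
  have h1 : (extChartAt (𝓡∂ n) p).symm ⁻¹' K ∩ (extChartAt (𝓡∂ n) p).target
      = extChartAt (𝓡∂ n) p '' K := by
    ext y
    constructor
    · rintro ⟨hy, hy'⟩
      exact ⟨_, hy, (extChartAt (𝓡∂ n) p).right_inv hy'⟩
    · rintro ⟨x, hx, rfl⟩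
      refine ⟨?_, (extChartAt (𝓡∂ n) p).map_source (hKs hx)⟩
      rw [mem_preimage, (extChartAt (𝓡∂ n) p).left_inv (hKs hx)]; exact hx
  rw [h1]
  have hc : IsCompact (extChartAt (𝓡∂ n) p '' K) :=
    hK.image_of_continuousOn ((continuousOn_extChartAt p).mono hKs)
  have hsub : extChartAt (𝓡∂ n) p '' K ⊆ (extChartAt (𝓡∂ n) p).target := by
    rw [← h1]; exact inter_subset_right
  exact (((continuousOn_sqrt_det_gram g p).mono hsub).integrableOn_compact hc).lintegral_lt_top

variable (n M) in
-- Compact pieces are needed because the volume density is controlled only on compact subsets of a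
-- chart target.
lemma exists_compact_chart_cover : ∃ (t : Finset M) (K : M → Set M),
    (∀ p, IsCompact (K p) ∧ K p ⊆ (extChartAt (𝓡∂ n) p).source) ∧ ⋃ p ∈ t, K p = univ := by
  have h : ∀ p : M, ∃ K : Set M, IsCompact K ∧ p ∈ interior K ∧
      K ⊆ (extChartAt (𝓡∂ n) p).source := fun p =>
    exists_compact_subset (isOpen_extChartAt_source p) (mem_extChartAt_source p)
  choose K hK using h
  obtain ⟨t, ht⟩ := isCompact_univ.elim_finite_subcover (fun p => interior (K p))
    (fun _ => isOpen_interior) fun p _ => mem_iUnion.2 ⟨p, (hK p).2.1⟩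
  exact ⟨t, K, fun p => ⟨(hK p).1, (hK p).2.2⟩, univ_subset_iff.1 (ht.trans
    (iUnion₂_mono fun p _ => interior_subset))⟩

/-- A supremum over all charts is hard to evaluate. By `chartVol_congr`, each chart measure agrees
on a piece of `K p` with the measure of the chart around `p`, so finitely many charts dominate.
Finiteness and measurability then become local questions. -/
lemma vol_le_sum (g : RMetric n M) {t : Finset M} {K : M → Set M}
    (hK : ∀ p, IsCompact (K p) ∧ K p ⊆ (extChartAt (𝓡∂ n) p).source)
    (hcover : ⋃ p ∈ t, K p = univ) :
    vol g ≤ ∑ p ∈ t, (chartVol g p).restrict (K p) := by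
  refine iSup_le fun q => Measure.le_iff.2 fun A hA => ?_
  change chartVol g q A ≤ _
  rw [← chartVol_inter_source g q hA, Measure.finsetSum_apply]
  set A' := A ∩ (extChartAt (𝓡∂ n) q).source with hA'
  have hA'm : MeasurableSet A' := hA.inter (measurableSet_source q)
  calc chartVol g q A' = chartVol g q (⋃ p ∈ t, A' ∩ K p) := by
        rw [← inter_iUnion₂, hcover, inter_univ]
    _ ≤ ∑ p ∈ t, chartVol g q (A' ∩ K p) := measure_biUnion_finset_le _ _
    _ ≤ ∑ p ∈ t, (chartVol g p).restrict (K p) A := by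
        refine Finset.sum_le_sum fun p _ => ?_
        rw [chartVol_congr g q p (hA'm.inter (hK p).1.measurableSet)
          (inter_subset_left.trans inter_subset_right) (inter_subset_right.trans (hK p).2),
          Measure.restrict_apply hA]
        exact measure_mono (inter_subset_inter_left _ inter_subset_left)

lemma isFiniteMeasure_vol (g : RMetric n M) : IsFiniteMeasure (vol g) := by
  obtain ⟨t, K, hK, hcover⟩ := exists_compact_chart_cover n M
  refine ⟨lt_of_le_of_lt (vol_le_sum g hK hcover univ) ?_⟩
  rw [Measure.finsetSum_apply]
  refine ENNReal.sum_lt_top.2 fun p _ => ?_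
  rw [Measure.restrict_apply_univ]
  exact chartVol_lt_top g (hK p).1 (hK p).2

/-- The chart maps `chartVol g p` back to the density measure on its target, and `V` is almost
everywhere its coordinate expression composed with the chart. -/
lemma aemeasurable_chartVol (g : RMetric n M) {V : M → ℝ} (hV : AEMeas0 (n := n) V) (p : M) :
    AEMeasurable V (chartVol g p) := by
  set ν := (volume.restrict (extChartAt (𝓡∂ n) p).target).withDensity
      fun y => ENNReal.ofReal (Real.sqrt (gram g p y).det) with hν
  have hac : ν ≪ volume.restrict (extChartAt (𝓡∂ n) p).target :=
    withDensity_absolutelyContinuous _ _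
  have hsymm : AEMeasurable (extChartAt (𝓡∂ n) p).symm ν := (aemeasurable_symm p).mono_ac hac
  have hmem : ∀ᵐ y ∂ν, y ∈ (extChartAt (𝓡∂ n) p).target :=
    hac.ae_le (ae_restrict_mem (measurableSet_target p))
  have hsrc : ∀ᵐ x ∂(chartVol g p), x ∈ (extChartAt (𝓡∂ n) p).source := by
    refine (ae_map_iff hsymm (p := fun x => x ∈ (extChartAt (𝓡∂ n) p).source)
      (measurableSet_source p)).2 ?_
    filter_upwards [hmem] with y hy using (extChartAt (𝓡∂ n) p).map_target hy
  have hext : AEMeasurable (extChartAt (𝓡∂ n) p) (chartVol g p) := by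
    have := (continuousOn_extChartAt (I := 𝓡∂ n) p).aemeasurable (measurableSet_source p)
      (μ := chartVol g p)
    rwa [Measure.restrict_eq_self_of_ae_mem hsrc] at this
  have hmap : Measure.map (extChartAt (𝓡∂ n) p) (chartVol g p) = ν := by
    rw [chartVol, AEMeasurable.map_map_of_aemeasurable hext hsymm]
    have : (extChartAt (𝓡∂ n) p ∘ (extChartAt (𝓡∂ n) p).symm) =ᵐ[ν] id := by
      filter_upwards [hmem] with y hy using (extChartAt (𝓡∂ n) p).right_inv hy
    rw [Measure.map_congr this, Measure.map_id]
  have h1 : AEMeasurable (comp0 V p) (Measure.map (extChartAt (𝓡∂ n) p) (chartVol g p)) := by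
    rw [hmap]; exact (hV p).mono_ac hac
  refine (h1.comp_aemeasurable hext).congr ?_
  filter_upwards [hsrc] with x hx
  simp only [Function.comp, comp0, (extChartAt (𝓡∂ n) p).left_inv hx]

lemma aemeasurable_finsetSum {ι : Type*} {t : Finset ι} {μ : ι → Measure M} {V : M → ℝ}
    (h : ∀ i ∈ t, AEMeasurable V (μ i)) : AEMeasurable V (∑ i ∈ t, μ i) := by
  induction t using Finset.cons_induction with
  | empty => simp
  | cons i t hi ih =>
    rw [Finset.sum_cons]
    exact (h i (Finset.mem_cons_self i t)).add_measure
      (ih fun j hj => h j (Finset.mem_cons_of_mem hj))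

lemma aemeasurable_vol (g : RMetric n M) {V : M → ℝ} (hV : AEMeas0 (n := n) V) :
    AEMeasurable V (vol g) := by
  obtain ⟨t, K, hK, hcover⟩ := exists_compact_chart_cover n M
  exact (aemeasurable_finsetSum fun p _ => (aemeasurable_chartVol g hV p).mono_measure
    Measure.restrict_le_self).mono_measure (vol_le_sum g hK hcover)

variable {g g' : RMetric n M} {ρ : M → ℝ}

lemma exists_bound {V : M → ℝ} (hV : Continuous V) : ∃ C, 0 < C ∧ ∀ x, V x ≤ C := by
  obtain ⟨C, hC⟩ := (isCompact_univ.image hV).bddAbove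
  exact ⟨max C 1, by positivity, fun x =>
    (hC (mem_image_of_mem V (mem_univ x))).trans (le_max_left _ _)⟩

/-- The density is multiplied by ρ^(n/2), which is bounded by compactness. -/
lemma IsConformal.vol_le (h : IsConformal g g' ρ) :
    ∃ C : ℝ≥0∞, C ≠ ⊤ ∧ vol g' ≤ C • vol g := by
  obtain ⟨C, hC0, hC⟩ := exists_bound h.smooth.continuous
  refine ⟨ENNReal.ofReal (Real.sqrt (C ^ n)), ENNReal.ofReal_ne_top, ?_⟩
  refine iSup_le fun p => Measure.le_iff.2 fun A hA => ?_
  change chartVol g' p A ≤ _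
  calc chartVol g' p A
      ≤ ENNReal.ofReal (Real.sqrt (C ^ n)) * chartVol g p A := by
        rw [chartVol_apply g' p hA, chartVol_apply g p hA,
          ← lintegral_const_mul' _ _ ENNReal.ofReal_ne_top]
        refine lintegral_mono fun y => ?_
        rw [← ENNReal.ofReal_mul (Real.sqrt_nonneg _), h.gram_eq p]
        refine ENNReal.ofReal_le_ofReal ?_
        simp only [Matrix.det_smul, Fintype.card_fin, comp0]
        rw [Real.sqrt_mul (pow_nonneg (h.pos _).le n)]
        refine mul_le_mul_of_nonneg_right (Real.sqrt_le_sqrt ?_) (Real.sqrt_nonneg _)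
        exact pow_le_pow_left₀ (h.pos _).le (hC _) n
    _ ≤ ENNReal.ofReal (Real.sqrt (C ^ n)) * vol g A :=
        mul_le_mul_right (chartVol_le_vol g p A) _

lemma IsConformal.vol_ac (h : IsConformal g g' ρ) : vol g' ≪ vol g := by
  obtain ⟨C, -, hC⟩ := h.vol_le
  exact Measure.absolutelyContinuous_of_le_smul hC

/-- The tool for moving L² bounds between the two metrics. The constant `D` is uniform in the
functions, as limits require; no measurability is needed, since only finite constants are pulled out
of integrals. -/
lemma IsConformal.exists_lintegral_le (h : IsConformal g g' ρ) (C : ℝ) :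
    ∃ D : ℝ≥0∞, D ≠ ⊤ ∧ ∀ (f f' : M → ℝ), (∀ x, f' x ≤ C * f x) → (∀ x, 0 ≤ f x) →
      ∫⁻ x, ENNReal.ofReal (f' x) ∂(vol g') ≤ D * ∫⁻ x, ENNReal.ofReal (f x) ∂(vol g) := by
  obtain ⟨C', hC't, hC'⟩ := h.vol_le
  refine ⟨C' * ENNReal.ofReal C, ENNReal.mul_ne_top hC't ENNReal.ofReal_ne_top,
    fun f f' hff' hf => ?_⟩
  calc ∫⁻ x, ENNReal.ofReal (f' x) ∂(vol g')
      ≤ ∫⁻ x, ENNReal.ofReal (f' x) ∂(C' • vol g) := lintegral_mono' hC' le_rfl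
    _ = C' * ∫⁻ x, ENNReal.ofReal (f' x) ∂(vol g) := by
        rw [lintegral_smul_measure, smul_eq_mul]
    _ ≤ C' * ∫⁻ x, ENNReal.ofReal C * ENNReal.ofReal (f x) ∂(vol g) := by
        refine mul_le_mul_right (lintegral_mono fun x => ?_) _
        rw [← ENNReal.ofReal_mul' (hf x)]
        exact ENNReal.ofReal_le_ofReal (hff' x)
    _ = C' * ENNReal.ofReal C * ∫⁻ x, ENNReal.ofReal (f x) ∂(vol g) := by
        rw [lintegral_const_mul' _ _ ENNReal.ofReal_ne_top, mul_assoc]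

end Volume

/-! ### Continuity and measurability of tensor operations -/

section Regularity

variable {n : ℕ} [NeZero n] {M : Type*} [TopologicalSpace M]
  [ChartedSpace (EuclideanHalfSpace n) M] [IsManifold (𝓡∂ n) ∞ M]

lemma continuousOn_gram_inv (g : RMetric n M) (p : M) (i j : Fin n) :
    ContinuousOn (fun y => (gram g p y)⁻¹ i j) (extChartAt (𝓡∂ n) p).target := by
  have h : ContinuousOn (gram g p) (extChartAt (𝓡∂ n) p).target :=
    continuousOn_pi.2 fun i => continuousOn_pi.2 fun j => (contDiffOn_gram g p i j).continuousOn
  have h1 : ContinuousOn (fun y => (gram g p y).det) (extChartAt (𝓡∂ n) p).target := by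
    rw [continuousOn_iff_continuous_domRestrict] at h ⊢
    exact h.matrix_det
  have h2 : ContinuousOn (fun y => (gram g p y).adjugate i j) (extChartAt (𝓡∂ n) p).target := by
    rw [continuousOn_iff_continuous_domRestrict] at h ⊢
    exact h.matrix_adjugate.matrix_elem i j
  refine ((h1.inv₀ fun y hy => (posDef_gram g hy).det_pos.ne').mul h2).congr fun y hy => ?_
  simp [Matrix.inv_def, Ring.inverse_eq_inv']

lemma continuous_of_comp0 {V : M → ℝ}
    (hV : ∀ p, ContinuousOn (comp0 (n := n) V p) (extChartAt (𝓡∂ n) p).target) :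
    Continuous V := by
  refine continuous_iff_continuousAt.2 fun x => ?_
  have h := (hV x).comp (continuousOn_extChartAt x) (extChartAt (𝓡∂ n) x).mapsTo
  refine (h.continuousAt (extChartAt_source_mem_nhds x)).congr ?_
  filter_upwards [extChartAt_source_mem_nhds (I := 𝓡∂ n) x] with z hz
  simp only [Function.comp, comp0, (extChartAt (𝓡∂ n) x).left_inv hz]

lemma continuous_inner1 (g : RMetric n M) {β δ : OneForm n M}
    (hβ : ∀ p i, ContinuousOn (fun y => comp1 β p y i) (extChartAt (𝓡∂ n) p).target)
    (hδ : ∀ p i, ContinuousOn (fun y => comp1 δ p y i) (extChartAt (𝓡∂ n) p).target) :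
    Continuous fun x => inner1 g x (β x) (δ x) := by
  refine continuous_of_comp0 (n := n) fun p => ContinuousOn.congr (f := fun y =>
    ∑ i, ∑ j, (gram g p y)⁻¹ i j * comp1 β p y i * comp1 δ p y j) ?_
    fun y hy => inner1_chart g hy β δ
  exact continuousOn_finsetSum _ fun i _ => continuousOn_finsetSum _ fun j _ =>
    ((continuousOn_gram_inv g p i j).mul (hβ p i)).mul (hδ p j)

lemma aemeasurable_target_of_continuousOn {f : E n → ℝ} {p : M}
    (hf : ContinuousOn f (extChartAt (𝓡∂ n) p).target) :
    AEMeasurable f (volume.restrict (extChartAt (𝓡∂ n) p).target) :=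
  hf.aemeasurable (measurableSet_target p)

lemma aemeas0_of_continuous {V : M → ℝ} (hV : Continuous V) : AEMeas0 (n := n) V := fun p =>
  aemeasurable_target_of_continuousOn (hV.comp_continuousOn (continuousOn_extChartAt_symm p))

lemma aemeas1_of_smooth {β : OneForm n M} (hβ : SmoothOneForm β) : AEMeas1 β := fun p i =>
  aemeasurable_target_of_continuousOn (contDiffOn_comp1 hβ p i).continuousOn

lemma continuousOn_comp1_dfun {φ : M → ℝ} (hφ : ContMDiff (𝓡∂ n) 𝓘(ℝ, ℝ) ∞ φ) (p : M)
    (i : Fin n) : ContinuousOn (fun y => comp1 (dfun φ) p y i) (extChartAt (𝓡∂ n) p).target :=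
  (continuousOn_pderiv (contDiffOn_comp0 hφ p) i).congr fun _ hy => comp1_dfun hφ hy i

lemma aemeas1_dfun {φ : M → ℝ} (hφ : ContMDiff (𝓡∂ n) 𝓘(ℝ, ℝ) ∞ φ) : AEMeas1 (n := n) (dfun φ) :=
  fun p i => aemeasurable_target_of_continuousOn (continuousOn_comp1_dfun hφ p i)

lemma aemeas2_metric (g : RMetric n M) : AEMeas2 g.inner := fun p i j =>
  aemeasurable_target_of_continuousOn (contDiffOn_gram g p i j).continuousOn

lemma aemeas0_inner1 (g : RMetric n M) {β δ : OneForm n M} (hβ : AEMeas1 β) (hδ : AEMeas1 δ) :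
    AEMeas0 (n := n) fun x => inner1 g x (β x) (δ x) := fun p => by
  refine AEMeasurable.congr (f := fun y =>
    ∑ i, ∑ j, (gram g p y)⁻¹ i j * comp1 β p y i * comp1 δ p y j) ?_ ?_
  · exact Finset.aemeasurable_fun_sum _ fun i _ => Finset.aemeasurable_fun_sum _ fun j _ =>
      ((aemeasurable_target_of_continuousOn (continuousOn_gram_inv g p i j)).mul (hβ p i)).mul (hδ p j)
  · filter_upwards [ae_restrict_mem (measurableSet_target p)] with y hy
    exact (inner1_chart g hy β δ).symm

lemma AEMeas1.smul {V : M → ℝ} {β : OneForm n M} (hV : AEMeas0 (n := n) V) (hβ : AEMeas1 β) :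
    AEMeas1 fun x => V x • β x := fun p i => (hV p).mul (hβ p i)

lemma AEMeas1.sub {β δ : OneForm n M} (hβ : AEMeas1 β) (hδ : AEMeas1 δ) :
    AEMeas1 fun x => β x - δ x := fun p i => (hβ p i).sub (hδ p i)

lemma AEMeas2.smul {V : M → ℝ} {h : TwoTensor n M} (hV : AEMeas0 (n := n) V) (hh : AEMeas2 h) :
    AEMeas2 fun x => V x • h x := fun p i j => (hV p).mul (hh p i j)

lemma AEMeas2.add {h k : TwoTensor n M} (hh : AEMeas2 h) (hk : AEMeas2 k) :
    AEMeas2 fun x => h x + k x := fun p i j => (hh p i j).add (hk p i j)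

lemma AEMeas2.sub {h k : TwoTensor n M} (hh : AEMeas2 h) (hk : AEMeas2 k) :
    AEMeas2 fun x => h x - k x := fun p i j => (hh p i j).sub (hk p i j)

lemma AEMeas1.smulRight {β δ : OneForm n M} (hβ : AEMeas1 β) (hδ : AEMeas1 δ) :
    AEMeas2 fun x => (β x).smulRight (δ x) := fun p i j => (hβ p i).mul (hδ p j)

end Regularity

/-! ### Conformal invariance of H¹₀ -/

section Sobolev

variable {n : ℕ} [NeZero n] {M : Type*} [TopologicalSpace M]
  [ChartedSpace (EuclideanHalfSpace n) M] [IsManifold (𝓡∂ n) ∞ M]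

lemma oneForm_ext {x : M} {β δ : TangentSpace (𝓡∂ n) x →L[ℝ] ℝ}
    (H : ∀ i, β (baseVec x i) = δ (baseVec x i)) : β = δ := by
  ext v
  rw [oneForm_apply_eq_sum β, oneForm_apply_eq_sum δ]
  simp only [H]

lemma dfun_inv {ρ : M → ℝ} (hρ : ContMDiff (𝓡∂ n) 𝓘(ℝ, ℝ) ∞ ρ)
    (hρ' : ContMDiff (𝓡∂ n) 𝓘(ℝ, ℝ) ∞ fun x => (ρ x)⁻¹) (hpos : ∀ x, 0 < ρ x) (x : M) :
    dfun (n := n) (fun x => (ρ x)⁻¹) x = (-(ρ x)⁻¹ ^ 2) • dfun ρ x := by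
  refine oneForm_ext fun i => ?_
  have hx := coord_mem_target (n := n) x
  rw [smul_apply, dfun_baseVec hρ', dfun_baseVec hρ, smul_eq_mul]
  have h := pderiv_mul (uniqueDiffWithinAt_range hx)
    (differentiableWithinAt_range (contDiffOn_comp0 hρ x) hx)
    (differentiableWithinAt_range (contDiffOn_comp0 hρ' x) hx) i
  have h1 : (fun z => comp0 (n := n) ρ x z * comp0 (fun x => (ρ x)⁻¹) x z) = fun _ => 1 :=
    funext fun z => mul_inv_cancel₀ (hpos _).ne'
  rw [h1, comp0_coord, comp0_coord] at h
  have h0 : pderiv (range (𝓡∂ n)) (fun _ => (1 : ℝ)) (coord x) i = 0 := by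
    simp [pderiv]
  rw [h0] at h
  have hne := (hpos x).ne'
  field_simp
  field_simp at h
  linarith

lemma dfun_const_mul_const_sub {U : M → ℝ} (hU : ContMDiff (𝓡∂ n) 𝓘(ℝ, ℝ) ∞ U) (c k : ℝ) (x : M) :
    dfun (n := n) (fun x => c * (k - U x)) x = (-c) • dfun U x := by
  refine oneForm_ext fun i => ?_
  have hx := coord_mem_target (n := n) x
  have hS := uniqueDiffWithinAt_range hx
  have hV : ContMDiff (𝓡∂ n) 𝓘(ℝ, ℝ) ∞ fun x => c * (k - U x) :=
    contMDiff_const.mul (contMDiff_const.sub hU)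
  rw [smul_apply, dfun_baseVec hV, dfun_baseVec hU, smul_eq_mul]
  have hd := differentiableWithinAt_range (contDiffOn_comp0 hU x) hx
  have : comp0 (n := n) (fun x => c * (k - U x)) x = fun z => c * (k - comp0 U x z) := rfl
  simp only [pderiv]
  rw [this, fderivWithin_const_mul hS (hd.const_sub k), fderivWithin_const_sub hS]
  simp

lemma confTerm_sub (g : RMetric n M) (ρ : M → ℝ) (w w' : OneForm n M) (x : M) :
    confTerm g ρ w x - confTerm g ρ w' x = confTerm g ρ (fun x => w x - w' x) x := by
  refine twoTensor_ext fun i j => ?_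
  simp only [confTerm, inner1_sub_right, sub_apply, add_apply, smul_apply,
    ContinuousLinearMap.smulRight_apply, smul_eq_mul]
  ring

/-- The skew part cancels. What remains is the multiple of the metric that the function `η` of an
`MP`-potential absorbs. -/
lemma confTerm_add_swap (g : RMetric n M) (ρ : M → ℝ) (w : OneForm n M) (x : M)
    (v v' : TangentSpace (𝓡∂ n) x) :
    confTerm g ρ w x v v' + confTerm g ρ w x v' v
      = inner1 g x (dfun ρ x) (w x) * g.inner x v v' := by
  simp only [confTerm, sub_apply, add_apply, smul_apply,
    ContinuousLinearMap.smulRight_apply, smul_eq_mul, g.symm x v' v]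
  ring

lemma aemeas2_confTerm (g : RMetric n M) {ρ : M → ℝ} (hρ : ContMDiff (𝓡∂ n) 𝓘(ℝ, ℝ) ∞ ρ)
    {w : OneForm n M} (hw : AEMeas1 w) : AEMeas2 (confTerm g ρ w) := by
  have hd := aemeas1_dfun (n := n) hρ
  have hc : ∀ c : ℝ, AEMeas0 (n := n) fun _ : M => c := fun c p => aemeasurable_const
  exact (((hd.smulRight hw).sub (hw.smulRight hd)).smul (hc (1 / 2))).add
    ((aemeas2_metric g).smul fun p => ((hc (1 / 2)) p).mul (aemeas0_inner1 g hd hw p))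

/-- The term is of order zero in `w`, hence controlled by the L² norm. In the constant, the skew
part contributes 2 and the metric part n/2, by Cauchy–Schwarz and |g|² = n. -/
lemma normSq2_confTerm_le (g : RMetric n M) (ρ : M → ℝ) (w : OneForm n M) (x : M) :
    normSq2 g x (confTerm g ρ w x) ≤
      (2 + n) * inner1 g x (dfun ρ x) (dfun ρ x) * inner1 g x (w x) (w x) := by
  set A := inner1 g x (dfun ρ x) (dfun ρ x) with hA
  set B := inner1 g x (w x) (w x) with hB
  have hA0 : 0 ≤ A := inner1_self_nonneg g x _
  have hB0 : 0 ≤ B := inner1_self_nonneg g x _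
  have h1 := normSq2_add_le g x
    ((1 / 2 : ℝ) • ((dfun ρ x).smulRight (w x) - (w x).smulRight (dfun ρ x)))
    (((1 / 2 : ℝ) * inner1 g x (dfun ρ x) (w x)) • g.inner x)
  have h2 : normSq2 g x ((dfun ρ x).smulRight (w x) - (w x).smulRight (dfun ρ x))
      ≤ 4 * (A * B) := by
    have e : (dfun ρ x).smulRight (w x) - (w x).smulRight (dfun ρ x)
        = (dfun ρ x).smulRight (w x) + (-1 : ℝ) • (w x).smulRight (dfun ρ x) := by
      refine twoTensor_ext fun i j => ?_
      simp only [sub_apply, add_apply, smul_apply, smul_eq_mul]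
      ring
    rw [e]
    refine (normSq2_add_le g x _ _).trans ?_
    rw [normSq2_smul, normSq2_smulRight, normSq2_smulRight, ← hA, ← hB]
    linarith
  have h3 := inner1_sq_le g x (dfun ρ x) (w x)
  rw [normSq2_smul, normSq2_smul, normSq2_metric] at h1
  rw [← hA, ← hB] at h3
  have hn : (0 : ℝ) ≤ n := Nat.cast_nonneg n
  have h4 : (n : ℝ) * inner1 g x (dfun ρ x) (w x) ^ 2 ≤ n * (A * B) :=
    mul_le_mul_of_nonneg_left h3 hn
  have h5 : 0 ≤ (n : ℝ) * (A * B) := by positivity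
  refine h1.trans ?_
  nlinarith

variable [MeasurableSpace M] [BorelSpace M] [T2Space M] [CompactSpace M]
  {g g' : RMetric n M} {ρ : M → ℝ}

/-- Additivity of the lower integral needs only one measurable summand, so nothing is asked of `f`
beyond its sign. -/
lemma lintegral_inner1_add (g : RMetric n M) {β : OneForm n M} (hβ : AEMeas1 β) (f : M → ℝ)
    (hf : ∀ x, 0 ≤ f x) :
    ∫⁻ x, ENNReal.ofReal (f x + inner1 g x (β x) (β x)) ∂(vol g)
      = ∫⁻ x, ENNReal.ofReal (f x) ∂(vol g)
        + ∫⁻ x, ENNReal.ofReal (inner1 g x (β x) (β x)) ∂(vol g) := by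
  rw [← lintegral_add_right' _ (aemeasurable_vol g (aemeas0_inner1 g hβ hβ)).ennreal_ofReal]
  exact lintegral_congr fun x => ENNReal.ofReal_add (hf x) (inner1_self_nonneg g x _)

lemma tendsto_zero_of_le_const_mul {a b : ℕ → ℝ≥0∞} {D : ℝ≥0∞} (hD : D ≠ ⊤)
    (hab : ∀ m, b m ≤ D * a m) (ha : Tendsto a atTop (𝓝 0)) : Tendsto b atTop (𝓝 0) := by
  have h := ENNReal.Tendsto.const_mul ha (Or.inr hD)
  rw [mul_zero] at h
  exact tendsto_of_tendsto_of_tendsto_of_le_of_le tendsto_const_nhds h (fun _ => zero_le) hab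

/-- The differential of a function does not involve the metric, so the same approximating sequence
works. -/
lemma IsConformal.isH10Fun (h : IsConformal g g' ρ) {φ : M → ℝ} {Dφ : OneForm n M}
    (hφ : IsH10Fun g φ Dφ) : IsH10Fun g' φ Dφ := by
  obtain ⟨hm, hm', φm, hsm, h1, h2⟩ := hφ
  obtain ⟨C, hC0, hC⟩ := exists_bound h.symm.smooth.continuous
  obtain ⟨D, hD, hDle⟩ := h.exists_lintegral_le 1
  obtain ⟨D', hD', hDle'⟩ := h.exists_lintegral_le C
  refine ⟨hm, hm', φm, hsm, ?_, ?_⟩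
  · exact tendsto_zero_of_le_const_mul hD
      (fun m => hDle _ _ (fun x => (one_mul _).ge) fun x => sq_nonneg _) h1
  · refine tendsto_zero_of_le_const_mul hD' (fun m => hDle' _ _ (fun x => ?_) fun x =>
      inner1_self_nonneg g x _) h2
    rw [h.inner1_eq]
    exact mul_le_mul_of_nonneg_right (hC x) (inner1_self_nonneg g x _)

/-- The approximants are multiplied by `ρ`, which keeps their supports in the interior. By
`covDeriv_eq` the error in the derivative is `ρ` times the old one plus `confTerm` of the error in
the form. -/
lemma IsConformal.isH10Form (h : IsConformal g g' ρ) {w : OneForm n M} {Dw : TwoTensor n M}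
    (hw : IsH10Form g w Dw) :
    IsH10Form g' (fun x => ρ x • w x) (fun x => ρ x • Dw x + confTerm g ρ w x) := by
  obtain ⟨hm, hm', wm, hsm, h1, h2⟩ := hw
  have hρm : AEMeas0 (n := n) ρ := aemeas0_of_continuous h.smooth.continuous
  obtain ⟨C, hC0, hC⟩ := exists_bound h.smooth.continuous
  obtain ⟨C', hC0', hC'⟩ := exists_bound h.symm.smooth.continuous
  obtain ⟨A, hA0, hA⟩ := exists_bound (continuous_inner1 g (continuousOn_comp1_dfun h.smooth)
    (continuousOn_comp1_dfun h.smooth))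
  obtain ⟨D, hD, hDle⟩ := h.exists_lintegral_le C
  -- The 2 bounds the derivative error, whose factor ρ² cancels against the norm of `g'`. The rest
  -- bounds `confTerm`, with `A` a bound for |dρ|² and `C'` one for 1/ρ.
  obtain ⟨D', hD', hDle'⟩ := h.exists_lintegral_le (2 + 2 * ((2 + n) * A) * C' ^ 2)
  refine ⟨hm.smul hρm, (hm'.smul hρm).add (aemeas2_confTerm g h.smooth hm),
    fun m x => ρ x • wm m x, fun m => ⟨smoothOneForm_smul h.smooth (hsm m).1,
      (closure_mono fun x hx => ?_).trans (hsm m).2⟩, ?_, ?_⟩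
  · exact fun h0 => hx (by simp only [h0, smul_zero])
  · refine tendsto_zero_of_le_const_mul hD (fun m => hDle _ _ (fun x => ?_) fun x =>
      inner1_self_nonneg g x _) h1
    change inner1 g' x (ρ x • wm m x - ρ x • w x) (ρ x • wm m x - ρ x • w x) ≤ _
    have e : ρ x • wm m x - ρ x • w x = ρ x • (wm m x - w x) := by
      refine oneForm_ext fun i => ?_
      simp only [sub_apply, smul_apply, smul_eq_mul]
      ring
    rw [h.inner1_eq, e, inner1_smul_smul, ← mul_assoc, ← mul_assoc,
      inv_mul_cancel₀ (h.pos x).ne', one_mul]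
    exact mul_le_mul_of_nonneg_right (hC x) (inner1_self_nonneg g x _)
  -- The order zero term involves `wm m - w` itself, so both convergences enter.
  · have h3 := h2.add h1
    rw [add_zero] at h3
    refine tendsto_zero_of_le_const_mul hD' (fun m => ?_) h3
    rw [← lintegral_inner1_add g ((aemeas1_of_smooth (hsm m).1).sub hm) _
      fun x => normSq2_nonneg g x _]
    refine hDle' _ _ (fun x => ?_) fun x =>
      add_nonneg (normSq2_nonneg g x _) (inner1_self_nonneg g x _)
    have e : covDeriv g' (fun x => ρ x • wm m x) x - (ρ x • Dw x + confTerm g ρ w x)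
        = ρ x • (covDeriv g (wm m) x - Dw x) + confTerm g ρ (fun x => wm m x - w x) x := by
      rw [h.covDeriv_eq (hsm m).1, ← confTerm_sub]
      refine twoTensor_ext fun i j => ?_
      simp only [sub_apply, add_apply, smul_apply, smul_eq_mul]
      ring
    rw [e, h.normSq2_eq]
    set X := normSq2 g x (covDeriv g (wm m) x - Dw x) with hX
    set B := inner1 g x (wm m x - w x) (wm m x - w x) with hB
    have hX0 : 0 ≤ X := normSq2_nonneg g x _
    have hB0 : 0 ≤ B := inner1_self_nonneg g x _
    have i1 := normSq2_add_le g x (ρ x • (covDeriv g (wm m) x - Dw x))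
      (confTerm g ρ (fun x => wm m x - w x) x)
    rw [normSq2_smul, ← hX] at i1
    have i2 := normSq2_confTerm_le g ρ (fun x => wm m x - w x) x
    rw [← hB] at i2
    have i3 : normSq2 g x (confTerm g ρ (fun x => wm m x - w x) x) ≤ (2 + n) * A * B :=
      i2.trans (mul_le_mul_of_nonneg_right
        (mul_le_mul_of_nonneg_left (hA x) (by positivity)) hB0)
    have hρ0 := h.pos x
    have i4 : (ρ x)⁻¹ ^ 2 ≤ C' ^ 2 := pow_le_pow_left₀ (inv_pos.2 hρ0).le (hC' x) 2
    calc (ρ x)⁻¹ ^ 2 * normSq2 g x (ρ x • (covDeriv g (wm m) x - Dw x)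
          + confTerm g ρ (fun x => wm m x - w x) x)
        ≤ (ρ x)⁻¹ ^ 2 * (2 * (ρ x ^ 2 * X) + 2 * ((2 + n) * A * B)) := by
          refine mul_le_mul_of_nonneg_left (i1.trans ?_) (by positivity)
          linarith
      _ = 2 * X + (ρ x)⁻¹ ^ 2 * (2 * ((2 + n) * A) * B) := by
          field_simp
      _ ≤ 2 * X + C' ^ 2 * (2 * ((2 + n) * A) * B) := by
          gcongr
      _ ≤ (2 + 2 * ((2 + n) * A) * C' ^ 2) * (X + B) := by
          have : 0 ≤ 2 * ((2 + n) * A) * C' ^ 2 * X := by positivity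
          nlinarith

/-- The definition does not list `u` in L². It follows because `u` is at finite L² distance from one
smooth approximant, which is bounded on a space of finite volume. -/
lemma IsH10Form.lintegral_lt_top {u : OneForm n M} {Du : TwoTensor n M} (hu : IsH10Form g u Du) :
    ∫⁻ x, ENNReal.ofReal (inner1 g x (u x) (u x)) ∂(vol g) < ⊤ := by
  obtain ⟨hm, -, um, hsm, h1, -⟩ := hu
  obtain ⟨m, hm1⟩ := (h1.eventually_lt_const (show (0 : ℝ≥0∞) < ⊤ by simp)).exists
  have hs := (hsm m).1
  have hcont : ∀ p i, ContinuousOn (fun y => comp1 (um m) p y i) (extChartAt (𝓡∂ n) p).target :=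
    fun p i => (contDiffOn_comp1 hs p i).continuousOn
  obtain ⟨A, hA0, hA⟩ := exists_bound (continuous_inner1 g hcont hcont)
  have := isFiniteMeasure_vol g
  calc ∫⁻ x, ENNReal.ofReal (inner1 g x (u x) (u x)) ∂(vol g)
      ≤ ∫⁻ x, ENNReal.ofReal 2 * (ENNReal.ofReal A + ENNReal.ofReal
          (inner1 g x (um m x - u x) (um m x - u x))) ∂(vol g) := by
        refine lintegral_mono fun x => ?_
        have h2 := inner1_add_le g x (um m x) ((-1 : ℝ) • (um m x - u x))
        rw [inner1_smul_smul, show um m x + (-1 : ℝ) • (um m x - u x) = u x from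
          oneForm_ext fun i => by simp only [sub_apply, add_apply, smul_apply, smul_eq_mul]; ring]
          at h2
        rw [← ENNReal.ofReal_add hA0.le (inner1_self_nonneg g x _),
          ← ENNReal.ofReal_mul (by norm_num)]
        refine ENNReal.ofReal_le_ofReal ?_
        have := hA x
        linarith
    _ < ⊤ := by
        rw [lintegral_const_mul' _ _ (by simp), lintegral_add_left measurable_const,
          lintegral_const]
        exact ENNReal.mul_lt_top (by simp) (ENNReal.add_lt_top.2
          ⟨ENNReal.mul_lt_top (by simp) (measure_lt_top _ _), hm1⟩)

end Sobolev

/-! ### Correspondence of square integrable fields and of potentials -/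

section Potential

variable {n : ℕ} [NeZero n] {M : Type*} [TopologicalSpace M]
  [ChartedSpace (EuclideanHalfSpace n) M] [IsManifold (𝓡∂ n) ∞ M]
  {g : RMetric n M} {α : OneForm n M} {U : M → ℝ} {k : ℝ}

lemma isConformal_reducedMetric (g : RMetric n M) (hU : ContMDiff (𝓡∂ n) 𝓘(ℝ, ℝ) ∞ U)
    (hk : ∀ x, U x < k) :
    IsConformal g (reducedMetric g U k hU hk) (fun x => 2 * (k - U x)) where
  smooth := contMDiff_const.mul (contMDiff_const.sub hU)
  pos x := by linarith [hk x]
  inner_eq _ := rfl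

variable [MeasurableSpace M] [BorelSpace M] [T2Space M] [CompactSpace M]

lemma memL2Pair_of_memL2Triple (hU : ContMDiff (𝓡∂ n) 𝓘(ℝ, ℝ) ∞ U)
    (hk : ∀ x, U x < k) {h : TwoTensor n M} {β : OneForm n M} {V : M → ℝ}
    (H : MemL2Triple g h β V) :
    MemL2Pair (reducedMetric g U k hU hk)
      (fun x => (2 * (k - U x)) • h x + V x • g.inner x) β := by
  obtain ⟨hsymm, h2, h1, h0, hfin⟩ := H
  have hc := isConformal_reducedMetric g hU hk
  obtain ⟨C, hC0, hC⟩ := exists_bound hc.symm.smooth.continuous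
  -- The coefficients of |h|², |β|² and V² are 2, C and 2nC²: the factor P of `h` cancels in the
  -- norm of the new metric, and |g|² = n.
  obtain ⟨D, hD, hDle⟩ := hc.exists_lintegral_le (2 + C + 2 * n * C ^ 2)
  refine ⟨fun x v w => ?_, (h2.smul (aemeas0_of_continuous hc.smooth.continuous)).add
    ((aemeas2_metric g).smul h0), h1, ?_⟩
  · simp only [add_apply, smul_apply, hsymm x v w, g.symm x v w]
  refine lt_of_le_of_lt (hDle _ _ (fun x => ?_) fun x => ?_) (ENNReal.mul_lt_top hD.lt_top hfin)
  · rw [hc.inner1_eq, hc.normSq2_eq]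
    have i1 := normSq2_add_le g x ((2 * (k - U x)) • h x) (V x • g.inner x)
    rw [normSq2_smul, normSq2_smul, normSq2_metric] at i1
    have hP : 0 < 2 * (k - U x) := hc.pos x
    have hCx : (2 * (k - U x))⁻¹ ≤ C := hC x
    set P := 2 * (k - U x) with hPdef
    have hX := normSq2_nonneg g x (h x)
    have hB := inner1_self_nonneg g x (β x)
    set X := normSq2 g x (h x)
    set B := inner1 g x (β x) (β x)
    have i4 : P⁻¹ ^ 2 ≤ C ^ 2 := pow_le_pow_left₀ (inv_pos.2 hP).le hCx 2
    have hV := sq_nonneg (V x)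
    have hn : (0 : ℝ) ≤ n := Nat.cast_nonneg n
    calc P⁻¹ ^ 2 * normSq2 g x (P • h x + V x • g.inner x) + P⁻¹ * B
        ≤ P⁻¹ ^ 2 * (2 * (P ^ 2 * X) + 2 * (V x ^ 2 * n)) + P⁻¹ * B := by gcongr
      _ = 2 * X + P⁻¹ ^ 2 * (2 * n * V x ^ 2) + P⁻¹ * B := by field_simp
      _ ≤ 2 * X + C ^ 2 * (2 * n * V x ^ 2) + C * B := by gcongr
      _ ≤ (2 + C + 2 * n * C ^ 2) * (X + B + V x ^ 2) := by
          have a1 : 0 ≤ C * X := by positivity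
          have a2 : 0 ≤ C * V x ^ 2 := by positivity
          have a3 : 0 ≤ 2 * n * C ^ 2 * (X + B) := by positivity
          nlinarith
  · have hX := normSq2_nonneg g x (h x)
    have hB := inner1_self_nonneg g x (β x)
    positivity

lemma memL2Triple_of_memL2Pair (hU : ContMDiff (𝓡∂ n) 𝓘(ℝ, ℝ) ∞ U)
    (hk : ∀ x, U x < k) {h : TwoTensor n M} {β : OneForm n M}
    (H : MemL2Pair (reducedMetric g U k hU hk) h β) :
    MemL2Triple g (fun x => (2 * (k - U x))⁻¹ • h x) β 0 := by
  obtain ⟨hsymm, h2, h1, hfin⟩ := H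
  have hc := isConformal_reducedMetric g hU hk
  obtain ⟨C, hC0, hC⟩ := exists_bound hc.smooth.continuous
  -- The norm of P⁻¹ h for `g` equals that of `h` for the reduced metric; the squared norm of `β`
  -- changes by the factor P ≤ C.
  obtain ⟨D, hD, hDle⟩ := hc.symm.exists_lintegral_le (1 + C)
  refine ⟨fun x v w => ?_, h2.smul (aemeas0_of_continuous hc.symm.smooth.continuous), h1,
    fun p => aemeasurable_const, ?_⟩
  · simp only [smul_apply, hsymm x v w]
  refine lt_of_le_of_lt (hDle _ _ (fun x => ?_) fun x => ?_) (ENNReal.mul_lt_top hD.lt_top hfin)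
  · rw [normSq2_smul, hc.inner1_eq, hc.normSq2_eq]
    have hP : 0 < 2 * (k - U x) := hc.pos x
    have hCx : 2 * (k - U x) ≤ C := hC x
    set P := 2 * (k - U x) with hPdef
    have hX := normSq2_nonneg g x (h x)
    have hB := inner1_self_nonneg g x (β x)
    set X := normSq2 g x (h x)
    set B := inner1 g x (β x) (β x)
    have e : B = P * (P⁻¹ * B) := by field_simp
    have hB' : 0 ≤ P⁻¹ * B := by positivity
    have hX' : 0 ≤ P⁻¹ ^ 2 * X := by positivity
    have : P * (P⁻¹ * B) ≤ C * (P⁻¹ * B) := mul_le_mul_of_nonneg_right hCx hB'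
    have : 0 ≤ C * (P⁻¹ ^ 2 * X) := by positivity
    simp only [Pi.zero_apply]
    nlinarith
  · exact add_nonneg (normSq2_nonneg _ x _) (inner1_self_nonneg _ x _)

/-- With V = 0 the third equation reads (k - U) η = (dU, w)_g. Hence -½ η P g is precisely the term
-(dU, w)_g g in the conformal change of dˢw. -/
lemma isMagneticPotential_of_isMPPotential (hU : ContMDiff (𝓡∂ n) 𝓘(ℝ, ℝ) ∞ U)
    (hk : ∀ x, U x < k) {h : TwoTensor n M} {β : OneForm n M}
    (H : IsMPPotential g α U k (fun x => (2 * (k - U x))⁻¹ • h x) β 0) :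
    IsMagneticPotential (reducedMetric g U k hU hk) α h β := by
  obtain ⟨w, Dw, φ, Dφ, η, hw, hφ, -, hae⟩ := H
  have hc := isConformal_reducedMetric g hU hk
  refine ⟨_, _, φ, Dφ, hc.isH10Form hw, hc.isH10Fun hφ, ?_⟩
  filter_upwards [hc.vol_ac.ae_le hae] with x ⟨e1, e2, e3⟩
  have hkU : k - U x ≠ 0 := (sub_pos.2 (hk x)).ne'
  refine ⟨fun v v' => ?_, fun v => ?_⟩
  · have e4 := e1 v v'
    have e5 := confTerm_add_swap g (fun x => 2 * (k - U x)) w x v v'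
    have e6 : inner1 g x (dfun (fun x => 2 * (k - U x)) x) (w x)
        = -2 * inner1 g x (dfun U x) (w x) := by
      have := inner1_smul_smul g x (dfun U x) (w x) (-2) 1
      rw [one_smul, mul_one] at this
      rw [dfun_const_mul_const_sub hU, this]
    rw [e6] at e5
    simp only [smul_apply, smul_eq_mul, add_apply, Pi.zero_apply] at e3 e4 e5 ⊢
    have e7 : h x v v' = 2 * (k - U x) * ((2 * (k - U x))⁻¹ * h x v v') := by
      field_simp
    rw [e7, e4]
    linear_combination (-1 / 2 : ℝ) * e5 + g.inner x v v' * e3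
  · rw [e2, hc.lorentzForce_eq, map_smul]
    simp only [smul_apply, smul_eq_mul]
    field_simp

lemma isMPPotential_of_isMagneticPotential (hU : ContMDiff (𝓡∂ n) 𝓘(ℝ, ℝ) ∞ U)
    (hk : ∀ x, U x < k) {h : TwoTensor n M} {β : OneForm n M} {V : M → ℝ}
    (hL2 : MemL2Triple g h β V)
    (H : IsMagneticPotential (reducedMetric g U k hU hk) α
      (fun x => (2 * (k - U x)) • h x + V x • g.inner x) β) :
    IsMPPotential g α U k h β V := by
  obtain ⟨u, Du, φ, Dφ, hu, hφ, hae⟩ := H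
  have hc := isConformal_reducedMetric g hU hk
  have hw := hc.symm.isH10Form hu
  set G := reducedMetric g U k hU hk with hG
  set P : M → ℝ := fun x => 2 * (k - U x) with hP
  set w : OneForm n M := fun x => (P x)⁻¹ • u x with hwdef
  -- Here d(P⁻¹) = 2 P⁻² dU; the factor P⁻¹ of the inverse metric cancels against u = P w.
  have hdU : ∀ x, inner1 G x (dfun (fun x => (P x)⁻¹) x) (u x)
      = 2 * (P x)⁻¹ ^ 2 * inner1 g x (dfun U x) (w x) := by
    intro x
    have hPx := hc.pos x
    rw [hc.inner1_eq, dfun_inv hc.smooth hc.symm.smooth hc.pos, hP,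
      dfun_const_mul_const_sub hU, smul_smul]
    have e1 : u x = P x • w x := by
      rw [hwdef]
      simp only [smul_smul]
      rw [mul_inv_cancel₀ hPx.ne', one_smul]
    rw [e1, inner1_smul_smul]
    simp only [hP] at hPx ⊢
    field_simp
  -- The function `η` is solved from the equation for `V`.
  refine ⟨w, _, φ, Dφ, fun x => (k - U x)⁻¹ * (V x + inner1 g x (dfun U x) (w x)), hw,
    hc.symm.isH10Fun hφ, ⟨?_, ?_⟩, ?_⟩
  · have h1 : AEMeas0 (n := n) fun x => inner1 g x (dfun U x) (w x) :=
      aemeas0_inner1 g (aemeas1_dfun hU) hw.1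
    have h2 : AEMeas0 (n := n) fun x => (k - U x)⁻¹ := aemeas0_of_continuous
      ((continuous_const.sub hU.continuous).inv₀ fun x => (sub_pos.2 (hk x)).ne')
    exact fun p => (h2 p).mul ((hL2.2.2.2.1 p).add (h1 p))
  · obtain ⟨A, hA0, hA⟩ := exists_bound (continuous_inner1 g (continuousOn_comp1_dfun hU)
      (continuousOn_comp1_dfun hU))
    obtain ⟨C, hC0, hC⟩ := exists_bound
      ((continuous_const.sub hU.continuous).inv₀ fun x => (sub_pos.2 (hk x)).ne')
    -- The case of factor 1 makes the comparison of integrals available for the single metric `g`.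
    have hid : IsConformal g g (fun _ => 1) :=
      ⟨contMDiff_const, fun _ => one_pos, fun x => (one_smul _ _).symm⟩
    obtain ⟨D, hD, hDle⟩ := hid.exists_lintegral_le (2 * C ^ 2 * (1 + A))
    have hsum : ∫⁻ x, ENNReal.ofReal (normSq2 g x (h x) + inner1 g x (β x) (β x) + V x ^ 2
        + inner1 g x (w x) (w x)) ∂(vol g) < ⊤ := by
      rw [lintegral_inner1_add g hw.1]
      · exact ENNReal.add_lt_top.2 ⟨hL2.2.2.2.2, hw.lintegral_lt_top⟩
      · intro x
        have := normSq2_nonneg g x (h x)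
        have := inner1_self_nonneg g x (β x)
        positivity
    refine lt_of_le_of_lt (hDle _ _ (fun x => ?_) fun x => ?_) (ENNReal.mul_lt_top hD.lt_top hsum)
    · have a1 := normSq2_nonneg g x (h x)
      have a2 := inner1_self_nonneg g x (β x)
      have a3 := inner1_self_nonneg g x (w x)
      have a4 := inner1_sq_le g x (dfun U x) (w x)
      have a5 := hA x
      have a6 : ((k - U x)⁻¹) ^ 2 ≤ C ^ 2 :=
        pow_le_pow_left₀ (inv_pos.2 (sub_pos.2 (hk x))).le (hC x) 2
      set I := inner1 g x (dfun U x) (w x)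
      set W := inner1 g x (w x) (w x)
      have a7 : I ^ 2 ≤ A * W := a4.trans (mul_le_mul_of_nonneg_right a5 a3)
      calc ((k - U x)⁻¹ * (V x + I)) ^ 2 = ((k - U x)⁻¹) ^ 2 * (V x + I) ^ 2 := by ring
        _ ≤ C ^ 2 * (V x + I) ^ 2 := by gcongr
        _ ≤ C ^ 2 * (2 * V x ^ 2 + 2 * (A * W)) := by
            gcongr
            nlinarith [sq_nonneg (V x - I)]
        _ = 2 * C ^ 2 * (V x ^ 2 + A * W) := by ring
        _ ≤ 2 * C ^ 2 * ((1 + A) * (normSq2 g x (h x) + inner1 g x (β x) (β x) + V x ^ 2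
              + W)) := by
            gcongr
            have b1 : 0 ≤ A * V x ^ 2 := by positivity
            have b2 : 0 ≤ A * normSq2 g x (h x) := by positivity
            have b3 : 0 ≤ A * inner1 g x (β x) (β x) := by positivity
            nlinarith
        _ = _ := by ring
    · have := normSq2_nonneg g x (h x)
      have := inner1_self_nonneg g x (β x)
      have := inner1_self_nonneg g x (w x)
      positivity
  · filter_upwards [hc.symm.vol_ac.ae_le hae] with x ⟨e1, e2⟩
    have hPx := hc.pos x
    have hkU : k - U x ≠ 0 := (sub_pos.2 (hk x)).ne'
    refine ⟨fun v v' => ?_, fun v => ?_, ?_⟩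
    · have e3 := e1 v v'
      have e5 := confTerm_add_swap G (fun x => (P x)⁻¹) u x v v'
      rw [hdU, hc.inner_eq] at e5
      simp only [smul_apply, smul_eq_mul, add_apply] at e3 e5 ⊢
      have e6 : (P x)⁻¹ * (P x * h x v v' + V x * g.inner x v v')
          = h x v v' + (P x)⁻¹ * V x * g.inner x v v' := by
        field_simp
      have e7 : 2 * (P x)⁻¹ ^ 2 * inner1 g x (dfun U x) (w x) * (P x * g.inner x v v')
          = 2 * (P x)⁻¹ * inner1 g x (dfun U x) (w x) * g.inner x v v' := by
        field_simp
      have e8 : (k - U x)⁻¹ = 2 * (P x)⁻¹ := by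
        simp only [hP]; field_simp
      rw [e3] at e6
      rw [e7] at e5
      rw [e8]
      linear_combination - e6 - (1 / 2 : ℝ) * e5
    · rw [e2, hc.lorentzForce_eq, map_smul]
      rfl
    · field_simp
      ring

end Potential

/-! ### Change of time on an interval -/

section Reparam

/-- The map `r` is the inverse of the primitive of `f`, and `S` is the integral of `f` over the
interval. -/
lemma exists_reparam {T : ℝ} (hT : 0 < T) {f : ℝ → ℝ} (hf : ContDiffOn ℝ 1 f (Icc 0 T))
    (hpos : ∀ t ∈ Icc 0 T, 0 < f t) :
    ∃ (S : ℝ) (r : ℝ → ℝ), 0 < S ∧ r 0 = 0 ∧ r S = T ∧ StrictMono r ∧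
      r '' Icc 0 S = Icc 0 T ∧ ContDiffOn ℝ 2 r (Icc 0 S) ∧
      ∀ s ∈ Icc 0 S, HasDerivWithinAt r (f (r s))⁻¹ (Icc 0 S) s := by
  -- Extending `f` by its end values keeps it continuous and bounded below by `m`, so its primitive
  -- is a bijection of the whole line and endpoints need no care when inverting.
  set F : ℝ → ℝ := IccExtend hT.le (domRestrict (Icc 0 T) f) with hF
  have hFf : ∀ t ∈ Icc 0 T, F t = f t := fun t ht => by
    rw [hF, IccExtend_of_mem _ _ ht]; rfl
  have hFc : Continuous F := by
    rw [hF]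
    exact (continuousOn_iff_continuous_domRestrict.1 hf.continuousOn).Icc_extend'
  obtain ⟨t₀, ht₀, hmin⟩ := isCompact_Icc.exists_isMinOn ⟨0, left_mem_Icc.2 hT.le⟩ hf.continuousOn
  set m := f t₀ with hm
  have hm0 : 0 < m := hpos t₀ ht₀
  have hFm : ∀ t, m ≤ F t := fun t => hmin (projIcc 0 T hT.le t).2
  set Φ : ℝ → ℝ := fun t => ∫ x in (0 : ℝ)..t, F x with hΦ
  have hΦd : ∀ t, HasDerivAt Φ (F t) t := fun t => hFc.integral_hasStrictDerivAt 0 t |>.hasDerivAt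
  have hΦ0 : Φ 0 = 0 := intervalIntegral.integral_same
  have hmono : StrictMono Φ := strictMono_of_deriv_pos fun t => by
    rw [(hΦd t).deriv]; exact hm0.trans_le (hFm t)
  have hΦm : Monotone fun t => Φ t - m * t := by
    have hd : ∀ t, HasDerivAt (fun t => Φ t - m * t) (F t - m) t := fun t => by
      simpa using (hΦd t).fun_sub ((hasDerivAt_id t).const_mul m)
    exact monotone_of_deriv_nonneg (fun t => (hd t).differentiableAt) fun t => by
      rw [(hd t).deriv]; linarith [hFm t]
  have hΦcont : Continuous Φ := continuous_iff_continuousAt.2 fun t => (hΦd t).continuousAt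
  have hsurj : Function.Surjective Φ := by
    refine hΦcont.surjective ?_ ?_
    · refine tendsto_atTop_mono' atTop ?_ (tendsto_id.const_mul_atTop hm0)
      filter_upwards [eventually_ge_atTop 0] with t ht
      have := hΦm ht
      simp only [hΦ0, mul_zero, sub_zero, id] at this ⊢
      linarith
    · refine tendsto_atBot_mono' atBot ?_ (tendsto_id.const_mul_atBot hm0)
      filter_upwards [eventually_le_atBot 0] with t ht
      have := hΦm ht
      simp only [hΦ0, mul_zero, sub_zero, id] at this ⊢
      linarith
  set e := hmono.orderIsoOfSurjective Φ hsurj with he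
  have heΦ : ∀ t, e t = Φ t := fun t => rfl
  set r : ℝ → ℝ := fun s => e.symm s with hr
  have hΦr : ∀ s, Φ (r s) = s := fun s => e.apply_symm_apply s
  have hrΦ : ∀ t, r (Φ t) = t := fun t => e.symm_apply_apply t
  have hrmono : StrictMono r := e.symm.strictMono
  have hrc : Continuous r := e.symm.continuous
  have hrd : ∀ s, HasDerivAt r (F (r s))⁻¹ s := fun s =>
    HasDerivAt.of_local_left_inverse hrc.continuousAt (hΦd (r s))
      (hm0.trans_le (hFm _)).ne' (Eventually.of_forall hΦr)
  have hS : 0 < Φ T := by rw [← hΦ0]; exact hmono hT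
  have hr0 : r 0 = 0 := by rw [← hΦ0, hrΦ, hΦ0]
  have hrS : r (Φ T) = T := hrΦ T
  have hmaps : MapsTo r (Icc 0 (Φ T)) (Icc 0 T) := fun s hs =>
    ⟨hr0 ▸ hrmono.monotone hs.1, hrS ▸ hrmono.monotone hs.2⟩
  have hd : ∀ s ∈ Icc 0 (Φ T), HasDerivWithinAt r (f (r s))⁻¹ (Icc 0 (Φ T)) s := fun s hs => by
    rw [← hFf _ (hmaps hs)]; exact (hrd s).hasDerivWithinAt
  have hu : UniqueDiffOn ℝ (Icc 0 (Φ T)) := uniqueDiffOn_Icc hS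
  have hderiv : ∀ s ∈ Icc 0 (Φ T), derivWithin r (Icc 0 (Φ T)) s = (f (r s))⁻¹ := fun s hs =>
    (hd s hs).derivWithin (hu s hs)
  have hne : ∀ s ∈ Icc 0 (Φ T), f (r s) ≠ 0 := fun s hs => (hpos _ (hmaps hs)).ne'
  have hdiff : DifferentiableOn ℝ r (Icc 0 (Φ T)) := fun s hs =>
    (hd s hs).differentiableWithinAt
  have h1 : ContDiffOn ℝ 1 r (Icc 0 (Φ T)) := by
    rw [contDiffOn_one_iff_derivWithin hu]
    refine ⟨hdiff, ContinuousOn.congr ?_ hderiv⟩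
    exact (hf.continuousOn.comp hrc.continuousOn hmaps).inv₀ hne
  refine ⟨Φ T, r, hS, hr0, hrS, hrmono, ?_, ?_, hd⟩
  · refine Subset.antisymm (image_subset_iff.2 hmaps) fun t ht => ⟨Φ t, ⟨?_, ?_⟩, hrΦ t⟩
    · rw [← hΦ0]; exact hmono.monotone ht.1
    · exact hmono.monotone ht.2
  -- The derivative 1/f(r) is C¹ because `f` and, by the previous step, `r` are C¹.
  · rw [show (2 : WithTop ℕ∞) = 1 + 1 from by norm_num, contDiffOn_succ_iff_derivWithin hu]
    refine ⟨hdiff, by simp, ContDiffOn.congr ?_ hderiv⟩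
    exact (hf.comp h1 hmaps).inv hne

/-- Integrability is transferred along with the integral, because the vanishing of a ray transform
includes the existence of its integrals. -/
lemma reparam_integral {S T : ℝ} (hS : 0 < S) (hT : 0 < T) {r q φ ψ : ℝ → ℝ}
    (hr : StrictMono r) (himage : r '' Icc 0 S = Icc 0 T)
    (hd : ∀ s ∈ Icc 0 S, HasDerivWithinAt r (q s) (Icc 0 S) s) (hq : ∀ s ∈ Icc 0 S, 0 < q s)
    (hψ : ∀ s ∈ Icc 0 S, ψ s = q s * φ (r s)) :
    (IntervalIntegrable φ volume 0 T ↔ IntervalIntegrable ψ volume 0 S) ∧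
      ∫ t in (0 : ℝ)..T, φ t = ∫ s in (0 : ℝ)..S, ψ s := by
  have e : EqOn ψ (fun s => |q s| • φ (r s)) (Icc 0 S) := fun s hs => by
    simp only [smul_eq_mul]
    rw [hψ s hs, abs_of_pos (hq s hs)]
  constructor
  · rw [intervalIntegrable_iff_integrableOn_Icc_of_le hT.le,
      intervalIntegrable_iff_integrableOn_Icc_of_le hS.le, ← himage,
      integrableOn_image_iff_integrableOn_abs_deriv_smul measurableSet_Icc hd hr.injective.injOn]
    exact (integrableOn_congr_fun e measurableSet_Icc).symm
  · rw [intervalIntegral.integral_of_le hT.le, intervalIntegral.integral_of_le hS.le,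
      ← integral_Icc_eq_integral_Ioc, ← integral_Icc_eq_integral_Ioc, ← himage,
      integral_image_eq_integral_abs_deriv_smul measurableSet_Icc hd hr.injective.injOn]
    exact (setIntegral_congr_fun measurableSet_Icc e).symm

end Reparam

/-! ### Conservation of energy in coordinates -/

section Energy

variable {n : ℕ} [NeZero n]

lemma fderivWithin_apply_eq_sum (S : Set (E n)) (f : E n → ℝ) (y v : E n) :
    fderivWithin ℝ f S y v = ∑ m, pderiv S f y m * v m := by
  conv_lhs => rw [← sum_smul_stdVec v]
  simp only [map_sum, map_smul, smul_eq_mul, pderiv]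
  exact Finset.sum_congr rfl fun m _ => mul_comm _ _

/-- Lowering the index removes the inverse matrix and leaves `X`. Paired with the velocity, the
three derivative terms of the Christoffel symbols coincide after renaming indices, so one survives.
-/
lemma sum_gram_mul_accel {S : Set (E n)} {γ : E n → Matrix (Fin n) (Fin n) ℝ}
    {a : E n → Fin n → ℝ} {u : E n → ℝ} {y v : E n} (hdet : IsUnit (γ y).det)
    (hsymm : ∀ i j, γ y i j = γ y j i) :
    ∑ i, ∑ j, γ y i j * accel S γ a u y v i * v j =
      - (1 / 2 : ℝ) * ∑ i, ∑ j, (∑ m, pderiv S (fun z => γ z i j) y m * v m) * v i * v j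
        - ∑ m, pderiv S u y m * v m := by
  set X : Fin n → ℝ := fun m => - (1 / 2 : ℝ) * (∑ i, ∑ j,
    (pderiv S (fun z => γ z j m) y i + pderiv S (fun z => γ z i m) y j
      - pderiv S (fun z => γ z i j) y m) * v i * v j)
    + ∑ i, magField S a y i m * v i - pderiv S u y m with hX
  have h1 : ∀ l, accel S γ a u y v l = ∑ m, (γ y)⁻¹ l m * X m := by
    intro l
    simp only [accel, christoffel, lorentz, hX, mul_add, mul_sub, Finset.sum_add_distrib,
      Finset.sum_sub_distrib]
    congr 1
    congr 1
    · simp only [Finset.mul_sum, Finset.sum_mul, ← Finset.sum_neg_distrib,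
        ← Finset.sum_add_distrib, ← Finset.sum_sub_distrib]
      calc _ = ∑ i, ∑ m, ∑ j, _ := Finset.sum_congr rfl fun i _ => Finset.sum_comm
        _ = ∑ m, ∑ i, ∑ j, _ := Finset.sum_comm
        _ = _ := Finset.sum_congr rfl fun m _ => Finset.sum_congr rfl fun i _ =>
          Finset.sum_congr rfl fun j _ => by ring
    · simp only [Finset.mul_sum, Finset.sum_mul]
      rw [Finset.sum_comm]
      exact Finset.sum_congr rfl fun i _ => Finset.sum_congr rfl fun j _ => by ring
  have h2 : ∀ j, ∑ i, γ y i j * accel S γ a u y v i = X j := by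
    intro j
    have h := congrArg (fun A => Matrix.mulVec A X j) (Matrix.mul_nonsing_inv (γ y) hdet)
    simp only [← Matrix.mulVec_mulVec, Matrix.one_mulVec] at h
    rw [← h]
    simp only [Matrix.mulVec, dotProduct, h1, hsymm j]
  have h3 : ∑ i, ∑ j, γ y i j * accel S γ a u y v i * v j = ∑ j, X j * v j := by
    rw [Finset.sum_comm]
    exact Finset.sum_congr rfl fun j _ => by rw [← h2 j, Finset.sum_mul]
  rw [h3]
  set R := ∑ i, ∑ j, (∑ m, pderiv S (fun z => γ z i j) y m * v m) * v i * v j with hR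
  have r1 : ∑ m, ∑ i, ∑ j, pderiv S (fun z => γ z i j) y m * v i * v j * v m = R := by
    simp only [hR, Finset.sum_mul]
    calc _ = ∑ i, ∑ m, ∑ j, _ := Finset.sum_comm
      _ = ∑ i, ∑ j, ∑ m, _ := Finset.sum_congr rfl fun i _ => Finset.sum_comm
      _ = _ := Finset.sum_congr rfl fun m _ => Finset.sum_congr rfl fun i _ =>
        Finset.sum_congr rfl fun j _ => by ring
  have r2 : ∑ m, ∑ i, ∑ j, pderiv S (fun z => γ z j m) y i * v i * v j * v m = R := by
    rw [← r1, Finset.sum_comm]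
    refine Finset.sum_congr rfl fun i _ => ?_
    rw [Finset.sum_comm]
    exact Finset.sum_congr rfl fun j _ => Finset.sum_congr rfl fun m _ => by ring
  have r3 : ∑ m, ∑ i, ∑ j, pderiv S (fun z => γ z i m) y j * v i * v j * v m = R := by
    rw [← r2]
    refine Finset.sum_congr rfl fun m _ => ?_
    rw [Finset.sum_comm]
    exact Finset.sum_congr rfl fun i _ => Finset.sum_congr rfl fun j _ => by ring
  -- The magnetic field is skew, so its force does no work.
  have r4 : ∑ m, (∑ i, magField S a y i m * v i) * v m = 0 := by
    have : ∑ m, (∑ i, magField S a y i m * v i) * v m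
        = - ∑ m, (∑ i, magField S a y i m * v i) * v m := by
      simp only [Finset.sum_mul, ← Finset.sum_neg_distrib]
      rw [Finset.sum_comm]
      exact Finset.sum_congr rfl fun i _ => Finset.sum_congr rfl fun j _ => by
        simp only [magField]; ring
    linarith
  have r5 : ∑ m, (∑ i, ∑ j, (pderiv S (fun z => γ z j m) y i + pderiv S (fun z => γ z i m) y j
      - pderiv S (fun z => γ z i j) y m) * v i * v j) * v m = R := by
    have : R = R + R - R := by ring
    rw [this]
    nth_rewrite 1 [← r2]
    nth_rewrite 1 [← r3]
    nth_rewrite 1 [← r1]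
    simp only [← Finset.sum_add_distrib, ← Finset.sum_sub_distrib, Finset.sum_mul]
    exact Finset.sum_congr rfl fun m _ => Finset.sum_congr rfl fun i _ =>
      Finset.sum_congr rfl fun j _ => by ring
  have h4 : ∀ m, X m * v m = - (1 / 2 : ℝ) * ((∑ i, ∑ j,
      (pderiv S (fun z => γ z j m) y i + pderiv S (fun z => γ z i m) y j
        - pderiv S (fun z => γ z i j) y m) * v i * v j) * v m)
      + (∑ i, magField S a y i m * v i) * v m - pderiv S u y m * v m := fun m => by
    simp only [hX]; ring
  simp only [h4, Finset.sum_add_distrib, Finset.sum_sub_distrib, ← Finset.mul_sum, r4, r5]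
  ring

lemma hasDerivWithinAt_energy {S : Set (E n)} {γ : E n → Matrix (Fin n) (Fin n) ℝ}
    {a : E n → Fin n → ℝ} {u : E n → ℝ} {c c' : ℝ → E n} {J : Set ℝ} {t : ℝ}
    (hγ : ∀ i j, DifferentiableWithinAt ℝ (fun z => γ z i j) S (c t))
    (hu : DifferentiableWithinAt ℝ u S (c t)) (hdet : IsUnit (γ (c t)).det)
    (hsymm : ∀ y i j, γ y i j = γ y j i) (hmaps : MapsTo c J S)
    (hc : HasDerivWithinAt c (c' t) J t)
    (hc' : HasDerivWithinAt c' (accel S γ a u (c t) (c' t)) J t) :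
    HasDerivWithinAt (fun s => (1 / 2 : ℝ) * (∑ i, ∑ j, γ (c s) i j * c' s i * c' s j) + u (c s))
      0 J t := by
  have h1 : ∀ i, HasDerivWithinAt (fun s => c' s i) (accel S γ a u (c t) (c' t) i) J t := fun i =>
    ((EuclideanSpace.proj i : E n →L[ℝ] ℝ).hasFDerivAt.comp_hasDerivWithinAt t hc')
  have h2 : ∀ {f : E n → ℝ}, DifferentiableWithinAt ℝ f S (c t) →
      HasDerivWithinAt (fun s => f (c s)) (∑ m, pderiv S f (c t) m * c' t m) J t := fun {f} hf => by
    rw [← fderivWithin_apply_eq_sum]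
    exact hf.hasFDerivWithinAt.comp_hasDerivWithinAt t hc hmaps
  have h3 := ((HasDerivWithinAt.fun_sum fun i (_ : i ∈ Finset.univ) =>
    HasDerivWithinAt.fun_sum fun j (_ : j ∈ Finset.univ) =>
      ((h2 (hγ i j)).fun_mul (h1 i)).fun_mul (h1 j)).const_mul (1 / 2 : ℝ)).fun_add (h2 hu)
  refine h3.congr_deriv ?_
  have h4 := sum_gram_mul_accel (S := S) (a := a) (u := u) (v := c' t) hdet (hsymm (c t))
  have h5 : ∑ i, ∑ j, γ (c t) i j * c' t i * accel S γ a u (c t) (c' t) j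
      = ∑ i, ∑ j, γ (c t) i j * accel S γ a u (c t) (c' t) i * c' t j := by
    rw [Finset.sum_comm]
    exact Finset.sum_congr rfl fun i _ => Finset.sum_congr rfl fun j _ => by
      rw [hsymm _ j i]; ring
  simp only [add_mul, Finset.sum_add_distrib]
  rw [h5, h4]
  ring

end Energy

/-! ### Geodesics and ray transforms of conformal systems -/

section Geodesic

variable {n : ℕ} [NeZero n] {M : Type*} [TopologicalSpace M]
  [ChartedSpace (EuclideanHalfSpace n) M] [IsManifold (𝓡∂ n) ∞ M]

lemma extChartAt_mem_range (p x : M) : extChartAt (𝓡∂ n) p x ∈ range (𝓡∂ n) := by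
  simp only [extChartAt, OpenPartialHomeomorph.extend_coe, Function.comp]
  exact mem_range_self _

section Curve

variable {σ : ℝ → M} {T t : ℝ}

lemma contDiffWithinAt_chart_curve (hσ : ContMDiffOn 𝓘(ℝ, ℝ) (𝓡∂ n) 2 σ (Icc 0 T))
    (ht : t ∈ Icc 0 T) {p : M} (hp : σ t ∈ (extChartAt (𝓡∂ n) p).source) :
    ContDiffWithinAt ℝ 2 (fun s => extChartAt (𝓡∂ n) p (σ s)) (Icc 0 T) t := by
  rw [← contMDiffWithinAt_iff_contDiffWithinAt]
  have h1 : ContMDiffAt (𝓡∂ n) 𝓘(ℝ, E n) 2 (extChartAt (𝓡∂ n) p) (σ t) :=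
    (contMDiffAt_extChartAt' (n := ∞) (by rwa [extChartAt_source] at hp)).of_le (by norm_cast)
  exact h1.comp_contMDiffWithinAt t (hσ t ht)

lemma eventually_mem_source (hσ : ContMDiffOn 𝓘(ℝ, ℝ) (𝓡∂ n) 2 σ (Icc 0 T))
    (ht : t ∈ Icc 0 T) {p : M} (hp : σ t ∈ (extChartAt (𝓡∂ n) p).source) :
    ∀ᶠ s in 𝓝[Icc 0 T] t, σ s ∈ (extChartAt (𝓡∂ n) p).source :=
  (hσ.continuousOn t ht).eventually ((isOpen_extChartAt_source p).mem_nhds hp)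

lemma velocity_eq_sum (hT : 0 < T) (hσ : ContMDiffOn 𝓘(ℝ, ℝ) (𝓡∂ n) 2 σ (Icc 0 T))
    (ht : t ∈ Icc 0 T) {p : M} (hp : σ t ∈ (extChartAt (𝓡∂ n) p).source) :
    velocity σ T t = ∑ i,
      derivWithin (fun s => extChartAt (𝓡∂ n) p (σ s)) (Icc 0 T) t i • coordVec p (σ t) i := by
  have hu : UniqueMDiffWithinAt 𝓘(ℝ, ℝ) (Icc 0 T) t :=
    ((uniqueDiffOn_Icc hT) t ht).uniqueMDiffWithinAt
  have hp' : σ t ∈ (chartAt (EuclideanHalfSpace n) p).source := by rwa [extChartAt_source] at hp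
  have h1 := mfderiv_comp_mfderivWithin (I := 𝓘(ℝ, ℝ)) (I' := 𝓡∂ n) (I'' := 𝓘(ℝ, E n))
    (g := extChartAt (𝓡∂ n) p) (f := σ) (s := Icc 0 T) t (mdifferentiableAt_extChartAt hp')
    ((hσ t ht).mdifferentiableWithinAt (by norm_num)) hu
  rw [mfderivWithin_eq_fderivWithin] at h1
  have h2 : derivWithin (fun s => extChartAt (𝓡∂ n) p (σ s)) (Icc 0 T) t
      = mfderiv (𝓡∂ n) 𝓘(ℝ, E n) (extChartAt (𝓡∂ n) p) (σ t) (velocity σ T t) :=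
    congrArg (fun L : ℝ →L[ℝ] E n => L 1) h1
  have h3 := mfderivWithin_extChartAt_symm_comp_mfderiv_extChartAt' (I := 𝓡∂ n) hp
  have h4 : (trivializationAt (E n) (TangentSpace (𝓡∂ n)) p).symmL ℝ (σ t)
      (mfderiv (𝓡∂ n) 𝓘(ℝ, E n) (extChartAt (𝓡∂ n) p) (σ t) (velocity σ T t))
        = velocity σ T t := by
    rw [TangentBundle.symmL_trivializationAt hp']
    exact congrArg (fun L : E n →L[ℝ] E n => L (velocity σ T t)) h3
  rw [← h4, ← h2]
  conv_lhs => rw [← sum_smul_stdVec (derivWithin (fun s => extChartAt (𝓡∂ n) p (σ s)) (Icc 0 T) t)]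
  simp only [map_sum, map_smul, coordVec]

lemma inner_velocity (g : RMetric n M) (hT : 0 < T)
    (hσ : ContMDiffOn 𝓘(ℝ, ℝ) (𝓡∂ n) 2 σ (Icc 0 T))
    (ht : t ∈ Icc 0 T) {p : M} (hp : σ t ∈ (extChartAt (𝓡∂ n) p).source) :
    g.inner (σ t) (velocity σ T t) (velocity σ T t) =
      ∑ i, ∑ j, gram g p (extChartAt (𝓡∂ n) p (σ t)) i j *
        derivWithin (fun s => extChartAt (𝓡∂ n) p (σ s)) (Icc 0 T) t i *
        derivWithin (fun s => extChartAt (𝓡∂ n) p (σ s)) (Icc 0 T) t j := by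
  rw [velocity_eq_sum hT hσ ht hp]
  simp only [map_sum, map_smul, sum_apply, smul_apply, smul_eq_mul, gram_extChartAt g hp,
    Finset.mul_sum]
  rw [Finset.sum_comm]
  exact Finset.sum_congr rfl fun i _ => Finset.sum_congr rfl fun j _ => by ring

lemma differentiableWithinAt_derivWithin_chart_curve (hT : 0 < T)
    (hσ : ContMDiffOn 𝓘(ℝ, ℝ) (𝓡∂ n) 2 σ (Icc 0 T))
    (ht : t ∈ Icc 0 T) {p : M} (hp : σ t ∈ (extChartAt (𝓡∂ n) p).source) :
    DifferentiableWithinAt ℝ (derivWithin (fun s => extChartAt (𝓡∂ n) p (σ s)) (Icc 0 T))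
      (Icc 0 T) t := by
  have h := ((contDiffWithinAt_chart_curve hσ ht hp).fderivWithin_right (m := 1)
    (uniqueDiffOn_Icc hT) (by norm_num) ht).differentiableWithinAt (by norm_num)
  exact h.clm_apply (differentiableWithinAt_const 1)

/-- The geodesic equation at time `t` is written in the chart around `σ t`. The energy is
independent of the chart, so these computations differentiate one function on the whole interval. -/
lemma energy_velocity_eq {g : RMetric n M} {α : OneForm n M} {U : M → ℝ}
    (hU : ContMDiff (𝓡∂ n) 𝓘(ℝ, ℝ) ∞ U) (h : IsGeodesic g α U σ T) (ht : t ∈ Icc 0 T) :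
    energy g U ⟨σ t, velocity σ T t⟩ = energy g U ⟨σ 0, velocity σ T 0⟩ := by
  obtain ⟨hT, hσ, hgeo⟩ := h
  have key : ∀ t ∈ Icc 0 T,
      HasDerivWithinAt (fun s => energy g U ⟨σ s, velocity σ T s⟩) 0 (Icc 0 T) t := by
    intro t ht
    set p := σ t with hp
    set c : ℝ → E n := fun s => extChartAt (𝓡∂ n) p (σ s) with hc
    have hps : σ t ∈ (extChartAt (𝓡∂ n) p).source := mem_extChartAt_source _
    have hct : c t ∈ (extChartAt (𝓡∂ n) p).target := (extChartAt (𝓡∂ n) p).map_source hps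
    have hcd : HasDerivWithinAt c (derivWithin c (Icc 0 T) t) (Icc 0 T) t :=
      ((contDiffWithinAt_chart_curve hσ ht hps).differentiableWithinAt
        (by norm_num)).hasDerivWithinAt
    have hcd' : HasDerivWithinAt (derivWithin c (Icc 0 T)) (accel (range (𝓡∂ n)) (gram g p)
        (comp1 α p) (comp0 U p) (c t) (derivWithin c (Icc 0 T) t)) (Icc 0 T) t := by
      rw [← hgeo t ht]
      exact (differentiableWithinAt_derivWithin_chart_curve hT hσ ht hps).hasDerivWithinAt
    have := hasDerivWithinAt_energy
      (fun i j => differentiableWithinAt_range (contDiffOn_gram g p i j) hct)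
      (differentiableWithinAt_range (contDiffOn_comp0 hU p) hct) (isUnit_det_gram g hct)
      (gram_symm g p) (fun s _ => extChartAt_mem_range p (σ s)) hcd hcd'
    have hev : ∀ s ∈ Icc 0 T, σ s ∈ (extChartAt (𝓡∂ n) p).source →
        energy g U ⟨σ s, velocity σ T s⟩ = (1 / 2 : ℝ) * (∑ i, ∑ j, gram g p (c s) i j *
          derivWithin c (Icc 0 T) s i * derivWithin c (Icc 0 T) s j) + comp0 U p (c s) := by
      intro s hs hsp
      rw [energy, inner_velocity g hT hσ hs hsp, comp0, (extChartAt (𝓡∂ n) p).left_inv hsp]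
    refine this.congr_of_eventuallyEq ?_ (hev t ht hps)
    filter_upwards [eventually_mem_source hσ ht hps, self_mem_nhdsWithin] with s h1 h2
    exact hev s h2 h1
  exact constant_of_derivWithin_zero (fun t ht => (key t ht).differentiableWithinAt)
    (fun t ht => (key t (Ico_subset_Icc_self ht)).derivWithin
      (uniqueDiffOn_Icc hT t (Ico_subset_Icc_self ht))) t ht

end Curve

variable {g g' : RMetric n M} {ρ : M → ℝ} {α : OneForm n M} {U U' : M → ℝ} {k k' : ℝ}
  {σ : ℝ → M} {S T : ℝ} {r : ℝ → ℝ}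

lemma velocity_comp (hS : 0 < S) (hσ : ContMDiffOn 𝓘(ℝ, ℝ) (𝓡∂ n) 2 σ (Icc 0 T))
    (hmaps : MapsTo r (Icc 0 S) (Icc 0 T)) {s q : ℝ} (hs : s ∈ Icc 0 S)
    (hr : HasDerivWithinAt r q (Icc 0 S) s) :
    velocity (n := n) (fun s => σ (r s)) S s = q • velocity σ T (r s) := by
  have hu : UniqueMDiffWithinAt 𝓘(ℝ, ℝ) (Icc 0 S) s :=
    ((uniqueDiffOn_Icc hS) s hs).uniqueMDiffWithinAt
  have h := mfderivWithin_comp (I := 𝓘(ℝ, ℝ)) (I' := 𝓘(ℝ, ℝ)) (I'' := 𝓡∂ n) (g := σ) (f := r)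
    (s := Icc 0 S) (u := Icc 0 T) s ((hσ _ (hmaps hs)).mdifferentiableWithinAt (by norm_num))
    hr.differentiableWithinAt.mdifferentiableWithinAt hmaps hu
  have h1 : mfderivWithin 𝓘(ℝ, ℝ) 𝓘(ℝ, ℝ) r (Icc 0 S) s (1 : ℝ) = q := by
    rw [mfderivWithin_eq_fderivWithin]
    exact hr.derivWithin (uniqueDiffOn_Icc hS s hs)
  have h2 : velocity (n := n) (fun s => σ (r s)) S s = mfderivWithin 𝓘(ℝ, ℝ) (𝓡∂ n) σ (Icc 0 T) (r s)
      (mfderivWithin 𝓘(ℝ, ℝ) 𝓘(ℝ, ℝ) r (Icc 0 S) s (1 : ℝ)) :=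
    congrArg (fun L : ℝ →L[ℝ] E n => L 1) h
  rw [h2, h1]
  have h3 : (q : ℝ) • (1 : ℝ) = q := mul_one q
  conv_lhs => rw [← h3]
  exact (mfderivWithin 𝓘(ℝ, ℝ) (𝓡∂ n) σ (Icc 0 T) (r s)).map_smul q (1 : ℝ)

/-- Differentiating P⁻¹ c' along `r` yields the right-hand side of `accel_conformal`. -/
lemma IsConformal.isGeodesic_comp (h : IsConformal g g' ρ)
    (hU : ContMDiff (𝓡∂ n) 𝓘(ℝ, ℝ) ∞ U) (hU' : ContMDiff (𝓡∂ n) 𝓘(ℝ, ℝ) ∞ U')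
    (hUU : ∀ x, U x = k - ρ x * (k' - U' x))
    (hσ : IsGeodesic g α U σ T) (hE : energy g U ⟨σ 0, velocity σ T 0⟩ = k)
    (hS : 0 < S) (hmaps : MapsTo r (Icc 0 S) (Icc 0 T)) (hrC : ContDiffOn ℝ 2 r (Icc 0 S))
    (hr : ∀ s ∈ Icc 0 S, HasDerivWithinAt r (ρ (σ (r s)))⁻¹ (Icc 0 S) s) :
    IsGeodesic g' α U' (fun s => σ (r s)) S := by
  have hσ' := hσ
  obtain ⟨hT, hσC, hgeo⟩ := hσ
  refine ⟨hS, hσC.comp hrC.contMDiffOn hmaps, fun s hs => ?_⟩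
  intro cγ
  set t := r s with ht
  have htm : t ∈ Icc 0 T := hmaps hs
  set p := σ t with hp
  set c : ℝ → E n := fun t => extChartAt (𝓡∂ n) p (σ t) with hc
  have hcγ : cγ = c ∘ r := rfl
  have hps : σ t ∈ (extChartAt (𝓡∂ n) p).source := mem_extChartAt_source _
  have hct : c t ∈ (extChartAt (𝓡∂ n) p).target := (extChartAt (𝓡∂ n) p).map_source hps
  set c' := derivWithin c (Icc 0 T) with hc'
  have hcd : ∀ t' ∈ Icc 0 T, σ t' ∈ (extChartAt (𝓡∂ n) p).source →
      HasDerivWithinAt c (c' t') (Icc 0 T) t' := fun t' ht' hp' =>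
    ((contDiffWithinAt_chart_curve hσC ht' hp').differentiableWithinAt
      (by norm_num)).hasDerivWithinAt
  have hcd' : HasDerivWithinAt c' (accel (range (𝓡∂ n)) (gram g p)
      (comp1 α p) (comp0 U p) (c t) (c' t)) (Icc 0 T) t := by
    rw [← hgeo t htm]
    exact (differentiableWithinAt_derivWithin_chart_curve hT hσC htm hps).hasDerivWithinAt
  set P := comp0 (n := n) ρ p with hP
  have hPpos : ∀ z, 0 < P z := fun z => h.pos _
  have hPc : ∀ t', σ t' ∈ (extChartAt (𝓡∂ n) p).source → P (c t') = ρ (σ t') := fun t' hp' => by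
    rw [hP, comp0, (extChartAt (𝓡∂ n) p).left_inv hp']
  have hu := uniqueDiffOn_Icc hS
  have hd1 : ∀ s' ∈ Icc 0 S, σ (r s') ∈ (extChartAt (𝓡∂ n) p).source →
      derivWithin cγ (Icc 0 S) s' = (P (c (r s')))⁻¹ • c' (r s') := fun s' hs' hp' => by
    rw [hPc _ hp']
    exact ((hcd _ (hmaps hs') hp').scomp s' (hr s' hs') hmaps).derivWithin (hu s' hs')
  have hrc : ContinuousWithinAt r (Icc 0 S) s := hrC.continuousOn s hs
  -- To be differentiated again, the formula for the first derivative is needed near `s`, where the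
  -- curve stays in the chart domain.
  have hev : derivWithin cγ (Icc 0 S) =ᶠ[𝓝[Icc 0 S] s]
      fun s' => (P (c (r s')))⁻¹ • c' (r s') := by
    have h1 := (hrc.tendsto_nhdsWithin hmaps).eventually (eventually_mem_source hσC htm hps)
    filter_upwards [h1, self_mem_nhdsWithin] with s' h2 h3
    exact hd1 s' h3 h2
  have hrs : HasDerivWithinAt r (P (c t))⁻¹ (Icc 0 S) s := by
    rw [hPc t hps]; exact hr s hs
  have hPd : DifferentiableWithinAt ℝ P (range (𝓡∂ n)) (c t) :=
    differentiableWithinAt_range (contDiffOn_comp0 h.smooth p) hct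
  have hPcd : HasDerivWithinAt (fun s' => P (c (r s')))
      (∑ m, pderiv (range (𝓡∂ n)) P (c t) m * ((P (c t))⁻¹ • c' t) m) (Icc 0 S) s := by
    rw [← fderivWithin_apply_eq_sum]
    exact hPd.hasFDerivWithinAt.comp_hasDerivWithinAt s
      ((hcd t htm hps).scomp s hrs hmaps) (fun s' _ => extChartAt_mem_range p _)
  have hder := (hPcd.fun_inv (hPpos _).ne').fun_smul (hcd'.scomp s hrs hmaps)
  have hval := (hder.congr_of_eventuallyEq hev (hd1 s hs hps)).derivWithin (hu s hs)
  -- The energy is prescribed only at time 0; conservation carries it to time `t`.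
  have henergy : (1 / 2 : ℝ) * (∑ i, ∑ j, gram g p (c t) i j * c' t i * c' t j)
      + comp0 U p (c t) = k := by
    rw [← hE, ← energy_velocity_eq hU hσ' htm, energy, inner_velocity g hT hσC htm hps, comp0,
      (extChartAt (𝓡∂ n) p).left_inv hps]
  have hacc := accel_conformal (S := range (𝓡∂ n)) (a := comp1 α p) (u := comp0 U p)
    (u' := comp0 U' p)
    (uniqueDiffWithinAt_range hct) hPd
    (fun i j => differentiableWithinAt_range (contDiffOn_gram g p i j) hct) (hPpos _).ne'
    (isUnit_det_gram g hct) (gram_symm g p (c t))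
    (differentiableWithinAt_range (contDiffOn_comp0 hU' p) hct) (fun z => hUU _) (c' t) henergy
  have hgram : gram g' p = fun y => P y • gram g p y := h.gram_eq p
  change derivWithin (derivWithin cγ (Icc 0 S)) (Icc 0 S) s = accel (range (𝓡∂ n)) (gram g' p)
    (comp1 α p) (comp0 U' p) (c t) (derivWithin cγ (Icc 0 S) s)
  rw [hval, hd1 s hs hps, hgram, hacc]
  ext l
  simp only [PiLp.add_apply, PiLp.sub_apply, PiLp.smul_apply, smul_eq_mul, Function.comp]
  rw [← ht]
  have e : ∑ m, pderiv (range (𝓡∂ n)) P (c t) m * ((P (c t))⁻¹ * c' t m)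
      = (P (c t))⁻¹ * ∑ m, pderiv (range (𝓡∂ n)) P (c t) m * c' t m := by
    rw [Finset.mul_sum]
    exact Finset.sum_congr rfl fun m _ => by ring
  rw [e]
  have := (hPpos (c t)).ne'
  field_simp
  ring

/-- Exit is a property of the trace of the curve, and the time change preserves the trace and maps
endpoints to endpoints. -/
lemma IsConformal.exists_exit_reparam (h : IsConformal g g' ρ)
    (hU : ContMDiff (𝓡∂ n) 𝓘(ℝ, ℝ) ∞ U) (hU' : ContMDiff (𝓡∂ n) 𝓘(ℝ, ℝ) ∞ U')
    (hUU : ∀ x, U x = k - ρ x * (k' - U' x)) {x : M} {v : TangentSpace (𝓡∂ n) x}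
    (hE : energy g U ⟨x, v⟩ = k) (hσ : IsExitGeodesic g α U ⟨x, v⟩ σ T) :
    ∃ (S : ℝ) (r : ℝ → ℝ), 0 < S ∧ StrictMono r ∧ r '' Icc 0 S = Icc 0 T ∧
      (∀ s ∈ Icc 0 S, HasDerivWithinAt r (ρ (σ (r s)))⁻¹ (Icc 0 S) s) ∧
      (∀ s ∈ Icc 0 S, velocity (n := n) (fun s => σ (r s)) S s = (ρ (σ (r s)))⁻¹ • velocity σ T (r s)) ∧
      IsExitGeodesic g' α U' ⟨x, (ρ x)⁻¹ • v⟩ (fun s => σ (r s)) S := by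
  obtain ⟨hgeo, hstart, hint, hbd⟩ := hσ
  have hT := hgeo.1
  have hσC := hgeo.2.1
  have hf : ContDiffOn ℝ 1 (fun t => ρ (σ t)) (Icc 0 T) := by
    rw [← contMDiffOn_iff_contDiffOn]
    exact (h.smooth.of_le (by norm_cast)).comp_contMDiffOn (hσC.of_le (by norm_num))
  obtain ⟨S, r, hS, hr0, hrS, hmono, himage, hrC, hr⟩ :=
    exists_reparam hT hf fun t _ => h.pos (σ t)
  have hmaps : MapsTo r (Icc 0 S) (Icc 0 T) := himage ▸ mapsTo_image r _
  have hvel : ∀ s ∈ Icc 0 S,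
      velocity (n := n) (fun s => σ (r s)) S s = (ρ (σ (r s)))⁻¹ • velocity σ T (r s) :=
    fun s hs => velocity_comp hS hσC hmaps hs (hr s hs)
  refine ⟨S, r, hS, hmono, himage, hr, hvel, ?_, ?_, fun s hs => ?_, ?_⟩
  · refine h.isGeodesic_comp hU hU' hUU hgeo ?_ hS hmaps hrC hr
    rw [StartsAt] at hstart
    rw [hstart, hE]
  · rw [StartsAt] at hstart ⊢
    rw [hvel 0 (left_mem_Icc.2 hS.le)]
    rw [hr0]
    exact congrArg (fun ξ : TangentBundle (𝓡∂ n) M =>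
      (⟨ξ.1, (ρ ξ.1)⁻¹ • ξ.2⟩ : TangentBundle (𝓡∂ n) M)) hstart
  · exact hint _ ⟨hr0 ▸ hmono hs.1, hrS ▸ hmono hs.2⟩
  · simp only [hrS]; exact hbd

lemma energy_toEnergy (g : RMetric n M) {x : M} (hk : U x < k) {w : TangentSpace (𝓡∂ n) x}
    (hw : w ≠ 0) : energy g U (toEnergy g U k x w) = k := by
  have hpos := g.pos x w hw
  have h0 : 0 ≤ 2 * (k - U x) / g.inner x w w := by
    have : 0 < k - U x := sub_pos.2 hk
    positivity
  change (1 / 2 : ℝ) * g.inner x (Real.sqrt (2 * (k - U x) / g.inner x w w) • w)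
    (Real.sqrt (2 * (k - U x) / g.inner x w w) • w) + U x = k
  simp only [map_smul, smul_apply, smul_eq_mul]
  rw [← mul_assoc (Real.sqrt _), Real.mul_self_sqrt h0]
  field_simp
  ring

/-- Both energy spheres are described by the same homogeneous coordinates `w`, so no comparison of
null sets is needed. -/
lemma IsConformal.toEnergy_eq (h : IsConformal g g' ρ) (hUU : ∀ x, U x = k - ρ x * (k' - U' x))
    (x : M) (w : TangentSpace (𝓡∂ n) x) :
    toEnergy g' U' k' x w = ⟨x, (ρ x)⁻¹ • (toEnergy g U k x w).2⟩ := by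
  have hρ := h.pos x
  simp only [toEnergy, h.inner_eq, smul_apply, smul_eq_mul]
  have e : 2 * (k' - U' x) / (ρ x * g.inner x w w)
      = (ρ x)⁻¹ ^ 2 * (2 * (k - U x) / g.inner x w w) := by
    rw [hUU]
    field_simp
    ring
  rw [e, Real.sqrt_mul (sq_nonneg _), Real.sqrt_sq (inv_pos.2 hρ).le]
  exact congrArg (fun v : TangentSpace (𝓡∂ n) x => (⟨x, v⟩ : TangentBundle (𝓡∂ n) M))
    (mul_smul _ _ _)

lemma sum_smul_frame_ne_zero (g : RMetric n M) {p : M} {y z : E n}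
    (hy : y ∈ (extChartAt (𝓡∂ n) p).target) (hz : z ≠ 0) : ∑ i, z i • frame p y i ≠ 0 := by
  intro h0
  have hz' : (fun i => z i) ≠ 0 := fun h => hz (by ext i; exact congrFun h i)
  have hpos := (posDef_gram g hy).dotProduct_mulVec_pos hz'
  have h1 : g.inner _ (∑ i, z i • frame p y i) (∑ i, z i • frame p y i)
      = star (fun i => z i) ⬝ᵥ (gram g p y).mulVec (fun i => z i) := by
    simp only [map_sum, map_smul, sum_apply, smul_apply, smul_eq_mul, dotProduct, Matrix.mulVec,
      gram, Finset.mul_sum, star_trivial]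
    rw [Finset.sum_comm]
    exact Finset.sum_congr rfl fun i _ => Finset.sum_congr rfl fun j _ => by ring
  rw [← h1, h0, map_zero] at hpos
  exact lt_irrefl _ hpos

/-- Systems with `(k - U) g = (k' - U') g'` have the same rays up to parametrization, so the ray
transforms vanish simultaneously when the integrands correspond. -/
lemma IsConformal.rayTransformEqZero (h : IsConformal g g' ρ)
    (hU : ContMDiff (𝓡∂ n) 𝓘(ℝ, ℝ) ∞ U) (hU' : ContMDiff (𝓡∂ n) 𝓘(ℝ, ℝ) ∞ U')
    (hUU : ∀ x, U x = k - ρ x * (k' - U' x)) (hk : ∀ x, U x < k)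
    {f f' : TwoTensor n M} {β β' : OneForm n M} {V V' : M → ℝ}
    (hf : ∀ (x : M) (v : TangentSpace (𝓡∂ n) x), energy g U ⟨x, v⟩ = k →
      f' x ((ρ x)⁻¹ • v) ((ρ x)⁻¹ • v) + β' x ((ρ x)⁻¹ • v) + V' x
        = (ρ x)⁻¹ * (f x v v + β x v + V x))
    (H : RayTransformEqZero g' α U' k' f' β' V') : RayTransformEqZero g α U k f β V := by
  intro p
  -- The same exceptional set of coordinates serves both systems.
  filter_upwards [H p] with zw hzw hmem hne hnonneg σ T hσ
  have hw : ∑ i, zw.2 i • frame p (bdryCoord zw.1) i ≠ 0 :=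
    sum_smul_frame_ne_zero g hmem hne
  set x := (extChartAt (𝓡∂ n) p).symm (bdryCoord zw.1) with hx
  have hzw' := hzw hmem hne hnonneg
  rw [h.toEnergy_eq hUU] at hzw'
  have hE := energy_toEnergy g (hk x) hw
  obtain ⟨S, r, hS, hmono, himage, hr, hvel, hexit⟩ :=
    h.exists_exit_reparam hU hU' hUU hE hσ
  have hmaps : MapsTo r (Icc 0 S) (Icc 0 T) := himage ▸ mapsTo_image r _
  obtain ⟨h1, h2⟩ := hzw' _ S hexit
  have hEt : ∀ t ∈ Icc 0 T, energy g U ⟨σ t, velocity σ T t⟩ = k := fun t ht => by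
    rw [energy_velocity_eq hU hσ.1 ht]
    have := hσ.2.1
    rw [StartsAt] at this
    rw [this, hE]
  obtain ⟨i1, i2⟩ := reparam_integral (φ := rayIntegrand f β V σ T)
    (ψ := rayIntegrand f' β' V' (fun s => σ (r s)) S) hS hσ.1.1 hmono himage hr
    (fun s _ => inv_pos.2 (h.pos _)) fun s hs => by
      simp only [rayIntegrand]
      rw [hvel s hs]
      exact hf _ _ (hEt _ (hmaps hs))
  exact ⟨i1.2 h1, i2.trans h2⟩

end Geodesic

end MPRay

end

/-! ### The equivalence -/

theorem mainTheorem6 {n : ℕ} [NeZero n] {M : Type*} [TopologicalSpace M] [T2Space M]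
    [CompactSpace M] [ChartedSpace (EuclideanHalfSpace n) M] [IsManifold (𝓡∂ n) ∞ M]
    [MeasurableSpace M] [BorelSpace M]
    (g : MPRay.RMetric n M) (α : MPRay.OneForm n M) (U : M → ℝ) (k : ℝ)
    (hα : MPRay.SmoothOneForm α) (hU : ContMDiff (𝓡∂ n) 𝓘(ℝ, ℝ) ∞ U) (hk : ∀ x, U x < k)
    (hsimple : MPRay.IsSimple g α U k) :
    MPRay.MagneticSInjective (MPRay.reducedMetric g U k hU hk) α ↔
      MPRay.MPSInjective g α U k := by
  have hc := MPRay.isConformal_reducedMetric g hU hk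
  have hP : ∀ x, 0 < 2 * (k - U x) := hc.pos
  constructor
  · intro H h β V hL2 hray
    refine MPRay.isMPPotential_of_isMagneticPotential hU hk hL2
      (H _ _ (MPRay.memL2Pair_of_memL2Triple hU hk hL2) ?_)
    -- Magnetic rays are converted back to `MP`-rays, so the inverse conformal factor is used.
    refine hc.symm.rayTransformEqZero contMDiff_const hU (k' := k) (fun x => ?_)
      (fun _ => one_half_pos) (fun x v hv => ?_) hray
    · change (0 : ℝ) = 1 / 2 - (2 * (k - U x))⁻¹ * (k - U x)
      have := (sub_pos.2 (hk x)).ne'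
      field_simp
      norm_num
    -- A G-unit vector has squared `g`-length P⁻¹; this turns the tensor V g into the function V.
    · have hv' : g.inner x v v = (2 * (k - U x))⁻¹ := by
        have h1 : (1 / 2 : ℝ) * ((2 * (k - U x)) * g.inner x v v) + 0 = 1 / 2 := hv
        exact eq_inv_of_mul_eq_one_right (by linarith)
      have := (hP x).ne'
      simp only [inv_inv, map_smul, add_apply, smul_apply, smul_eq_mul, Pi.zero_apply, hv']
      generalize 2 * (k - U x) = P at *
      field_simp
      ring
  · intro H h β hL2 hray
    -- The triple [P⁻¹ h, β, 0] is used. Without a V term the integrands match for every vector, on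
    -- or off the energy level.
    refine MPRay.isMagneticPotential_of_isMPPotential hU hk
      (H _ _ _ (MPRay.memL2Triple_of_memL2Pair hU hk hL2) ?_)
    refine hc.rayTransformEqZero hU contMDiff_const (fun x => ?_) hk (fun x v _ => ?_) hray
    · change U x = k - 2 * (k - U x) * (1 / 2 - 0)
      ring
    · simp only [map_smul, smul_apply, smul_eq_mul, Pi.zero_apply]
      ring
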